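/- **Theorem 1 (finite-key security bound for Round-Robin Differential Phase Shift QKD).** Let $d\ge 3$ be the qudit dimension; time indices $t\in\{0,\dots,d-1\}$ are added modulo $d$. Write $\log$ for the logarithm to base 2, $|\mu_a\rangle=\frac1{\sqrt d}\sum_t(-1)^{a_t}|t\rangle$ and $Q_a=\frac d{2^d}|\mu_a\rangle\langle\mu_a|$ for $a\in\{0,1\}^d$ (Alice's POVM), and $M^{(r)}_{ks}=\frac12|\Psi^{(r)}_{ks}\rangle\langle\Psi^{(r)}_{ks}|$ with $|\Psi^{(r)}_{ks}\rangle=\frac{|k\rangle+(-1)^s|k+r\rangle}{\sqrt2}$ for $r\in\{1,\dots,d-1\}$ (Bob's POVMs). *One round (EPR version).* Eve prepares an arbitrary two-qudit state $\hat\rho^{AB}$. Alice and Bob apply a common uniformly random permutation of the basis states and then common uniformly random phase flips $|t\rangle\mapsto(-1)^{c_t}|t\rangle$ to both qudits; averaging over these gives the state $\bar\rho^{AB}$, and Eve holds a purification $|\Psi^{ABE}\rangle$ of it. The round has bit error rate $b$: for all $a,k,s$ and all $r\neq0$, $$\mathrm{tr}\big[(Q_a\otimes M^{(r)}_{ks})\bar\rho^{AB}\big]=\frac{1}{2^d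 d}\cdot\begin{cases}1-b,& s=a_k\oplus a_{k+r},\\ b,& \text{otherwise.}\end{cases}$$ Let $\sigma^{rk}_{s'}$ be Eve's normalised ancilla state given $r$, $k$ and Alice's secret bit $s'=a_k\oplus a_{k+r}$. *Protocol.* There are $n$ rounds, attacked independently of each other, where round $i$ has its own state, purification and bit error rate $b_i$, and $\frac1n\sum_i b_i\le\beta$ for some $\beta\ge0$ (in particular, Eve may use the same coupling with error rate $\beta$ in every round). Let $\mathbf r=(r_1,\dots,r_n)$ and $\mathbf k=(k_1,\dots,k_n)$ be the values in the $n$ rounds and $x=(s'_1,\dots,s'_n)$ Alice's bits. The key is $z=\mathrm{Ext}(x,u)\in\{0,1\}^\ell$, where $u$ is a public seed, uniform on a finite set, and $\mathrm{Ext}$ is a universal hash function: $\Pr_u[\mathrm{Ext}(x,u)=\mathrm{Ext}(y,u)]\le2^{-\ell}$ for $x\ne y$. The joint state of Eve's ancillas is $$\omega(z,u,\mathbf r,\mathbf k)=2^{\ell-n}\sum_{x\in\{0,1\}^n:\ \mathrm{Ext}(x,u)=z}\ \bigotimes_{i=1}^n\sigma^{r_ik_i}_{x_i},$$ and the distance of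 $Z$ from uniformity given all of Eve's information is, with $z$ and $u$ uniform in $\mathbb E$, $$\mathcal D\big(Z|U,\mathbf r,\mathbf k,\omega\big)=\tfrac12\Big\|\mathbb E_{z,u}|z\rangle\langle z|\otimes|u\rangle\langle u|\otimes\big(\omega(z,u,\mathbf r,\mathbf k)-\mathbb E_{z'}\omega(z',u,\mathbf r,\mathbf k)\big)\Big\|_1 .$$ *Claim.* The equation $$\Big(1-\frac{x}{d-2}\Big)^{\frac12}+\Big(1+\frac1{d-2}\Big)\Big(1-\frac{x}{d-2}\Big)^{-\frac12}+\frac1{\sqrt{d-2}}\Big(\sqrt x-\frac1{\sqrt x}\Big)-2=0$$ has exactly one solution $x_d$ in $(0,1)$. Put $\beta_*=\dfrac{x_d/2}{1+x_d}$ and $$T=\begin{cases}2\beta+\sqrt{1-2\beta}\Big[\sqrt{1-2\beta\frac{d-1}{d-2}}+\frac{\sqrt{2\beta}}{\sqrt{d-2}}\Big],&\beta\le\beta_*,\\[2mm] 2\beta_*+\sqrt{1-2\beta_*}\Big[\sqrt{1-2\beta_*\frac{d-1}{d-2}}+\frac{\sqrt{2\beta_*}}{\sqrt{d-2}}\Big],&\beta\ge\beta_*.\end{cases}$$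 Then for all $n$, $\ell$, all such attacks and universal hash functions, and all $\mathbf r$, $\mathbf k$, $$\mathcal D\big(Z|U,\mathbf r,\mathbf k,\omega(Z,U,\mathbf r,\mathbf k)\big)<\frac12\sqrt{2^{\,\ell-n(1-2\log T)}} .$$ -/

import Mathlib

open scoped Kronecker Nat ComplexOrder

namespace RRDPS

noncomputable section

/-! ### Finite-dimensional quantum states -/

/-- Density matrices: positive semidefinite of trace one. -/
def IsDensity {ι : Type*} [Fintype ι] (ρ : Matrix ι ι ℂ) : Prop :=
  ρ.PosSemidef ∧ ρ.trace = 1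

/-- The rank-one operator `|v⟩⟨v|`. -/
def ketBra {ι : Type*} (v : ι → ℂ) : Matrix ι ι ℂ :=
  Matrix.vecMulVec v (star v)

/-- The trace norm `‖A‖₁ = tr √(A† A)`. -/
def traceNorm {ι : Type*} [Fintype ι] [DecidableEq ι] (A : Matrix ι ι ℂ) : ℝ :=
  (Matrix.trace (cfc Real.sqrt (A.conjTranspose * A))).re

/-- The trace distance `D(ρ, σ) = ½ ‖ρ - σ‖₁`. -/
def traceDist {ι : Type*} [Fintype ι] [DecidableEq ι] (ρ σ : Matrix ι ι ℂ) : ℝ :=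
  1 / 2 * traceNorm (ρ - σ)

/-- Partial trace over the first tensor factor. -/
def ptraceLeft {ι ε : Type*} [Fintype ι] (X : Matrix (ι × ε) (ι × ε) ℂ) : Matrix ε ε ℂ :=
  Matrix.of fun e e' => ∑ p, X (p, e) (p, e')

/-- Partial trace over the second tensor factor. -/
def ptraceRight {ι ε : Type*} [Fintype ε] (X : Matrix (ι × ε) (ι × ε) ℂ) : Matrix ι ι ℂ :=
  Matrix.of fun p q => ∑ e, X (p, e) (q, e)

/-- `Ψ` is a purification of `ρ` with ancilla space `ℂ^ε`. -/
def IsPurification {ι ε : Type*} [Fintype ε] (ρ : Matrix ι ι ℂ) (Ψ : ι × ε → ℂ) : Prop :=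
  ptraceRight (ketBra Ψ) = ρ

/-- The tensor product `⨂ i, A i` of a finite family of operators. -/
def tensorFamily {n : ℕ} {ε : Fin n → Type*} (A : ∀ i, Matrix (ε i) (ε i) ℂ) :
    Matrix (∀ i, ε i) (∀ i, ε i) ℂ :=
  Matrix.of fun e e' => ∏ i, A i (e i) (e' i)

/-- The classical-quantum state `𝔼_x |x⟩⟨x| ⊗ ω(x)` with `x` uniform. -/
def cqState {α ε : Type*} [Fintype α] [DecidableEq α] (ω : α → Matrix ε ε ℂ) :
    Matrix (α × ε) (α × ε) ℂ :=
  (1 / (Fintype.card α : ℂ)) • ∑ x, Matrix.single x x (1 : ℂ) ⊗ₖ ω x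

/-- The distance from uniformity of a uniform `Z` given a uniform classical `U` and the quantum
state `ω(Z, U)`: the trace distance between `𝔼_{z,u} |zu⟩⟨zu| ⊗ ω(z,u)` and
`𝔼_{z,u} |zu⟩⟨zu| ⊗ 𝔼_{z'} ω(z',u)`. -/
def distFromUniform {ζ υ ε : Type*} [Fintype ζ] [DecidableEq ζ] [Fintype υ] [DecidableEq υ]
    [Fintype ε] [DecidableEq ε] (ω : ζ → υ → Matrix ε ε ℂ) : ℝ :=
  traceDist (cqState fun p : ζ × υ => ω p.1 p.2)
    (cqState fun p : ζ × υ => (1 / (Fintype.card ζ : ℂ)) • ∑ z', ω z' p.2)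

/-! ### The measurements of Alice and Bob; time indices live in `Fin d` (addition modulo `d`) -/

/-- The sign `(-1)^b`. -/
def sgn (b : Bool) : ℂ := if b then -1 else 1

/-- `|μ_a⟩ = d^{-1/2} ∑_t (-1)^{a_t} |t⟩`. -/
def mu {d : ℕ} (a : Fin d → Bool) : Fin d → ℂ :=
  fun t => (1 / (Real.sqrt d : ℂ)) * sgn (a t)

/-- Alice's POVM element `Q_a = (d / 2^d) |μ_a⟩⟨μ_a|`. -/
def aliceQ {d : ℕ} (a : Fin d → Bool) : Matrix (Fin d) (Fin d) ℂ :=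
  ((d : ℂ) / 2 ^ d) • ketBra (mu a)

/-- `|Ψ^{(r)}_{ks}⟩ = (|k⟩ + (-1)^s |k+r⟩) / √2`. -/
def bobPsi {d : ℕ} (r k : Fin d) (s : Bool) : Fin d → ℂ :=
  (1 / (Real.sqrt 2 : ℂ)) • (Pi.single k (1 : ℂ) + sgn s • Pi.single (k + r) (1 : ℂ))

/-- Bob's POVM element `M^{(r)}_{ks} = ½ |Ψ^{(r)}_{ks}⟩⟨Ψ^{(r)}_{ks}|`. -/
def bobM {d : ℕ} (r k : Fin d) (s : Bool) : Matrix (Fin d) (Fin d) ℂ :=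
  (1 / 2 : ℂ) • ketBra (bobPsi r k s)

/-! ### Symmetrisation of the two-qudit state -/

/-- Average over all permutations of the time indices, applied to both qudits. -/
def permAverage {d : ℕ} (ρ : Matrix (Fin d × Fin d) (Fin d × Fin d) ℂ) :
    Matrix (Fin d × Fin d) (Fin d × Fin d) ℂ :=
  (1 / (d ! : ℂ)) • ∑ π : Equiv.Perm (Fin d), ρ.submatrix (Prod.map π π) (Prod.map π π)

/-- The phase flip `|t⟩ ↦ (-1)^{c_t} |t⟩` applied to both qudits. -/
def phaseFlip {d : ℕ} (c : Fin d → Bool) : Matrix (Fin d × Fin d) (Fin d × Fin d) ℂ :=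
  Matrix.diagonal (fun t => sgn (c t)) ⊗ₖ Matrix.diagonal (fun t => sgn (c t))

/-- Average over all phase flips. -/
def flipAverage {d : ℕ} (ρ : Matrix (Fin d × Fin d) (Fin d × Fin d) ℂ) :
    Matrix (Fin d × Fin d) (Fin d × Fin d) ℂ :=
  (1 / (2 ^ d : ℂ)) • ∑ c : Fin d → Bool, phaseFlip c * ρ * (phaseFlip c).conjTranspose

/-- The state of Alice and Bob after the random permutation and the random phase flips. -/
def symmetrise {d : ℕ} (ρ : Matrix (Fin d × Fin d) (Fin d × Fin d) ℂ) :
    Matrix (Fin d × Fin d) (Fin d × Fin d) ℂ :=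
  flipAverage (permAverage ρ)

/-- The noise constraint: for every `r ≠ 0` the outcomes `(a, k, s)` have probability
`(1 - b) / (2^d d)` if `s = a_k ⊕ a_{k+r}` and `b / (2^d d)` otherwise, so that the bit error
probability is `b` for every `(a, k, r)`. -/
def NoiseConstraint {d : ℕ} (ρ : Matrix (Fin d × Fin d) (Fin d × Fin d) ℂ) (b : ℝ) : Prop :=
  ∀ (a : Fin d → Bool) (k : Fin d) (s : Bool) (r : Fin d), (r : ℕ) ≠ 0 →
    ((aliceQ a ⊗ₖ bobM r k s) * ρ).trace =
      ((1 / (2 ^ d * d) * (if s = xor (a k) (a (k + r)) then 1 - b else b) : ℝ) : ℂ)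

/-! ### Eve's ancilla -/

/-- Eve's unnormalised state after the outcomes `a` and `(k, s)`; its trace is the probability of
these outcomes (given `r`). -/
def eveOutcome {d : ℕ} {ε : Type*} [Fintype ε] [DecidableEq ε] (Ψ : (Fin d × Fin d) × ε → ℂ)
    (a : Fin d → Bool) (r k : Fin d) (s : Bool) : Matrix ε ε ℂ :=
  ptraceLeft (ketBra Ψ * ((aliceQ a ⊗ₖ bobM r k s) ⊗ₖ (1 : Matrix ε ε ℂ)))

/-- Eve's unnormalised state given `r`, `k` and Alice's bit `s' = a_k ⊕ a_{k+r}`. -/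
def eveBitOutcome {d : ℕ} {ε : Type*} [Fintype ε] [DecidableEq ε] (Ψ : (Fin d × Fin d) × ε → ℂ)
    (r k : Fin d) (s' : Bool) : Matrix ε ε ℂ :=
  ∑ a : Fin d → Bool, ∑ s : Bool, if xor (a k) (a (k + r)) = s' then eveOutcome Ψ a r k s else 0

/-- Eve's (normalised) ancilla state `σ^{rk}_{s'}` given `r`, `k` and Alice's bit `s'`. -/
def eveState {d : ℕ} {ε : Type*} [Fintype ε] [DecidableEq ε] (Ψ : (Fin d × Fin d) × ε → ℂ)
    (r k : Fin d) (s' : Bool) : Matrix ε ε ℂ :=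
  (eveBitOutcome Ψ r k s').trace⁻¹ • eveBitOutcome Ψ r k s'

/-! ### Privacy amplification -/

/-- `Ext` is a universal hash function from `n` bits to `ℓ` bits with uniform seed in `υ`: distinct
inputs collide with probability at most `2^{-ℓ}`. -/
def IsUniversalHash {n ℓ : ℕ} {υ : Type*} [Fintype υ]
    (Ext : (Fin n → Bool) → υ → (Fin ℓ → Bool)) : Prop :=
  ∀ x y : Fin n → Bool, x ≠ y →
    (((Finset.univ.filter fun u => Ext x u = Ext y u).card : ℝ) / Fintype.card υ) ≤ 1 / 2 ^ ℓ

/-- The joint state of Eve's `n` ancillas,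
`ω(z, u, r, k) = 2^{ℓ-n} ∑_{x : Ext(x,u) = z} ⨂_i σ^{r_i k_i}_{x_i}`. -/
def eveJointState {d n ℓ : ℕ} {υ : Type*} {ε : Fin n → Type*} [∀ i, Fintype (ε i)]
    [∀ i, DecidableEq (ε i)] (Ext : (Fin n → Bool) → υ → (Fin ℓ → Bool))
    (Ψ : ∀ i, (Fin d × Fin d) × ε i → ℂ) (r k : Fin n → Fin d) (z : Fin ℓ → Bool) (u : υ) :
    Matrix (∀ i, ε i) (∀ i, ε i) ℂ :=
  ((2 : ℂ) ^ ℓ / 2 ^ n) • ∑ x : Fin n → Bool,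
    if Ext x u = z then tensorFamily (fun i => eveState (Ψ i) (r i) (k i) (x i)) else 0

/-! ### The quantities in the bound -/

/-- The left-hand side of the equation that determines `x_d`. -/
def satFun (d : ℕ) (x : ℝ) : ℝ :=
  (1 - x / ((d : ℝ) - 2)) ^ (1 / 2 : ℝ)
    + (1 + 1 / ((d : ℝ) - 2)) * (1 - x / ((d : ℝ) - 2)) ^ (-(1 / 2) : ℝ)
    + 1 / Real.sqrt ((d : ℝ) - 2) * (Real.sqrt x - 1 / Real.sqrt x) - 2

/-- `2β + √(1-2β) [√(1 - 2β (d-1)/(d-2)) + √(2β) / √(d-2)]`. -/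
def leakBase (d : ℕ) (β : ℝ) : ℝ :=
  2 * β + Real.sqrt (1 - 2 * β) *
    (Real.sqrt (1 - 2 * β * (((d : ℝ) - 1) / ((d : ℝ) - 2)))
      + Real.sqrt (2 * β) / Real.sqrt ((d : ℝ) - 2))

/-- The saturation value `β_* = (x/2) / (1 + x)`. -/
def betaStar (x : ℝ) : ℝ := x / 2 / (1 + x)

/-- `T` as a function of `d`, the saturation value `βs` and `β`. -/
def leakT (d : ℕ) (βs β : ℝ) : ℝ :=
  if β ≤ βs then leakBase d β else leakBase d βs

end

end RRDPS

namespace RRDPS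

noncomputable section

/-! ### The saturation equation and the concavity of the leakage -/

/-! One round. The random phase flips kill every matrix entry in which some time index occurs an odd
number of times, and the random permutation identifies most of the others. With m = k + r, four real
numbers remain: A at (kk,kk), B at (kk,mm), p at (km,km) and q at (km,mk). The relevant ancilla
vectors therefore split into orthogonal families: (kk ± mm)/√2 with squared norms A ± B, (km ±
mk)/√2 with p ± q, and tk, tm for t ∉ {k, m} with p. Alice's bit enters only as the sign of the
coherence between the first two families, within each sector ±. The last family, of total weight P =
d(d-2)p, says nothing about the bit, and the noise constraint forces P ≤ 2b.

Hashing. A weighted Cauchy–Schwarz inequality (`traceNorm_le_of_factor`) replaces the trace norm by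
a quadratic form in the coefficients of Eve's states. Averaged over the universal hash, the terms x
≠ y have a nonpositive coefficient and a nonnegative kernel, so only x = y survives; there the
factor 2^ℓ - 1 appears, which makes the final inequality strict. Everything is multiplicative over
rounds (`distFromUniform_le`). With suitable weights one round contributes tr √((σ₀² + σ₁²)/2),
which is at most its value for B = q = 0, and that is `leakBase d (P / 2)` (`exists_roundFactor`).

Many rounds. As a function of P the leakage is concave with slope `-satFun d x / 2` at P = x/(1+x),
so x_d locates its maximum. Tangent lines and the inequality of arithmetic and geometric means bound
the product over rounds by the n-th power of T (`prod_leakBase_le`). -/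

theorem satFun_eq {d : ℕ} {x : ℝ} (hw : 0 ≤ 1 - x / ((d : ℝ) - 2)) :
    satFun d x = √(1 - x / ((d : ℝ) - 2))
      + (1 + 1 / ((d : ℝ) - 2)) / √(1 - x / ((d : ℝ) - 2))
      + 1 / √((d : ℝ) - 2) * (√x - 1 / √x) - 2 := by
  rw [satFun, Real.rpow_neg hw, ← Real.sqrt_eq_rpow, div_eq_mul_inv (1 + 1 / ((d : ℝ) - 2))]

theorem one_sub_div_pos {c x : ℝ} (hc : 1 ≤ c) (hx1 : x < 1) : 0 < 1 - x / c := by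
  have : x / c < 1 := by rw [div_lt_one (by linarith)]; linarith
  linarith

/-- With c = d - 2, the map u ↦ u + (1 + 1/c)/u decreases on (0, 1), and u = √(1 - x/c) decreases in
x; the remaining term √x - 1/√x increases. -/
theorem satFun_strictMonoOn {d : ℕ} (hd : 3 ≤ d) : StrictMonoOn (satFun d) (Set.Ioo 0 1) := by
  have hd' : (3 : ℝ) ≤ d := by exact_mod_cast hd
  rintro x ⟨hx0, hx1⟩ y ⟨hy0, hy1⟩ hxy
  have hc : (1 : ℝ) ≤ (d : ℝ) - 2 := by linarith
  set c := (d : ℝ) - 2 with hcdef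
  have hc0 : 0 < c := by linarith
  have hwx := one_sub_div_pos hc hx1
  have hwy := one_sub_div_pos hc hy1
  rw [satFun_eq hwx.le, satFun_eq hwy.le, ← hcdef]
  have hsx : 0 < √x := Real.sqrt_pos.2 hx0
  have hsxy : √x < √y := Real.sqrt_lt_sqrt hx0.le hxy
  have huy : 0 < √(1 - y / c) := Real.sqrt_pos.2 hwy
  have huyx : √(1 - y / c) < √(1 - x / c) := by
    apply Real.sqrt_lt_sqrt hwy.le
    have : x / c < y / c := by gcongr
    linarith
  have hux1 : √(1 - x / c) < 1 := by
    rw [Real.sqrt_lt' one_pos]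
    have : 0 < x / c := by positivity
    linarith
  generalize √(1 - y / c) = v at *
  generalize √(1 - x / c) = u at *
  have h1 : 1 / √c * (√x - 1 / √x) < 1 / √c * (√y - 1 / √y) := by
    have : 1 / √y < 1 / √x := by gcongr
    have : 0 < 1 / √c := by positivity
    gcongr
  have h2 : u + (1 + 1 / c) / u < v + (1 + 1 / c) / v := by
    have hu : 0 < u := huy.trans huyx
    have hm : 0 < 1 / c := by positivity
    have : (v + (1 + 1 / c) / v) - (u + (1 + 1 / c) / u)
        = (u - v) * ((1 + 1 / c) - u * v) / (u * v) := by field_simp; ring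
    have h3 : 0 < (u - v) * ((1 + 1 / c) - u * v) / (u * v) := by
      have : u * v < 1 := by nlinarith
      apply div_pos (mul_pos (by linarith) (by linarith)) (by positivity)
    linarith
  linarith

theorem continuousOn_satFun {d : ℕ} (hd : 3 ≤ d) : ContinuousOn (satFun d) (Set.Ioo 0 1) := by
  have hd' : (3 : ℝ) ≤ d := by exact_mod_cast hd
  have hw : ∀ x ∈ Set.Ioo (0 : ℝ) 1, 0 < 1 - x / ((d : ℝ) - 2) :=
    fun x hx => one_sub_div_pos (by linarith) hx.2
  refine ContinuousOn.congr (f := fun x => √(1 - x / ((d : ℝ) - 2))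
      + (1 + 1 / ((d : ℝ) - 2)) / √(1 - x / ((d : ℝ) - 2))
      + 1 / √((d : ℝ) - 2) * (√x - 1 / √x) - 2) ?_ fun x hx => satFun_eq (hw x hx).le
  have h1 : ∀ x ∈ Set.Ioo (0 : ℝ) 1, √(1 - x / ((d : ℝ) - 2)) ≠ 0 :=
    fun x hx => (Real.sqrt_pos.2 (hw x hx)).ne'
  have h2 : ∀ x ∈ Set.Ioo (0 : ℝ) 1, √x ≠ 0 := fun x hx => (Real.sqrt_pos.2 hx.1).ne'
  have h3 : Continuous fun x : ℝ => √(1 - x / ((d : ℝ) - 2)) := by fun_prop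
  have h4 : Continuous fun x : ℝ => √x := by fun_prop
  exact (((h3.continuousOn.add (continuousOn_const.div h3.continuousOn h1)).add
    (continuousOn_const.mul (h4.continuousOn.sub
      (continuousOn_const.div h4.continuousOn h2)))).sub continuousOn_const)

theorem exists_satFun_neg {d : ℕ} (hd : 3 ≤ d) : ∃ x ∈ Set.Ioo (0 : ℝ) 1, satFun d x < 0 := by
  have hd' : (3 : ℝ) ≤ d := by exact_mod_cast hd
  have hc : (1 : ℝ) ≤ (d : ℝ) - 2 := by linarith
  set c := (d : ℝ) - 2 with hcdef
  have hc0 : 0 < c := by linarith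
  have hsc : 1 ≤ √c := Real.one_le_sqrt.2 hc
  have hscc : √c * √c = c := Real.mul_self_sqrt hc0.le
  -- For this x the last term equals 1/(4c) - 4, which outweighs the others: they add up to at most
  -- 1 + 20/9 - 2.
  refine ⟨1 / (16 * c), ⟨by positivity, ?_⟩, ?_⟩
  · rw [div_lt_one (by positivity)]; linarith
  have hs : √(1 / (16 * c)) = 1 / (4 * √c) := by
    rw [Real.sqrt_eq_iff_mul_self_eq (by positivity) (by positivity)]
    field_simp
    nlinarith
  have hw : (15 / 16 : ℝ) ≤ 1 - 1 / (16 * c) / c := by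
    have : 1 / (16 * c) / c ≤ 1 / 16 := by
      rw [div_div, div_le_div_iff₀ (by positivity) (by positivity)]
      nlinarith
    linarith
  rw [satFun_eq (by rw [← hcdef]; linarith), ← hcdef, hs]
  have hu1 : √(1 - 1 / (16 * c) / c) ≤ 1 := by
    rw [Real.sqrt_le_one]
    have : 0 ≤ 1 / (16 * c) / c := by positivity
    linarith
  have hu0 : (9 / 10 : ℝ) ≤ √(1 - 1 / (16 * c) / c) := Real.le_sqrt_of_sq_le (by linarith)
  generalize √(1 - 1 / (16 * c) / c) = u at *
  have h1 : (1 + 1 / c) / u ≤ 20 / 9 := by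
    rw [div_le_iff₀ (by linarith)]
    have : 1 / c ≤ 1 := by rw [div_le_one hc0]; exact hc
    linarith
  have h2 : 1 / √c * (1 / (4 * √c) - 1 / (1 / (4 * √c))) = 1 / (4 * c) - 4 := by
    field_simp
    nlinarith
  have h3 : 1 / (4 * c) ≤ 1 / 4 := by
    rw [div_le_div_iff₀ (by positivity) (by positivity)]; linarith
  rw [h2]
  linarith

theorem exists_satFun_pos {d : ℕ} (hd : 3 ≤ d) : ∃ x ∈ Set.Ioo (0 : ℝ) 1, 0 < satFun d x := by
  have hd' : (3 : ℝ) ≤ d := by exact_mod_cast hd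
  have hc : (1 : ℝ) ≤ (d : ℝ) - 2 := by linarith
  set c := (d : ℝ) - 2 with hcdef
  have hc0 : 0 < c := by linarith
  have hsc : 1 ≤ √c := Real.one_le_sqrt.2 hc
  have hscc : √c * √c = c := Real.mul_self_sqrt hc0.le
  -- Here y = √x. The terms in u, less 2, always leave at least 1/c, and for this y the term y - 1/y
  -- costs at most 2/(7c) < 1/c.
  set y : ℝ := 1 - 1 / (8 * c) with hy
  have h8 : 1 / (8 * c) ≤ 1 / 8 := by
    rw [div_le_div_iff₀ (by positivity) (by positivity)]; linarith
  have h80 : 0 < 1 / (8 * c) := by positivity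
  have hy0 : 0 < y := by linarith
  have hy1 : y < 1 := by linarith
  have hyy : y ^ 2 < 1 := by nlinarith
  refine ⟨y ^ 2, ⟨by positivity, hyy⟩, ?_⟩
  have hw := one_sub_div_pos hc hyy
  rw [satFun_eq hw.le, ← hcdef, Real.sqrt_sq hy0.le]
  have hu : 0 < √(1 - y ^ 2 / c) := Real.sqrt_pos.2 hw
  have hu1 : √(1 - y ^ 2 / c) ≤ 1 := by
    rw [Real.sqrt_le_one]
    have : 0 ≤ y ^ 2 / c := by positivity
    linarith
  generalize √(1 - y ^ 2 / c) = u at *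
  have h1 : 2 + 1 / c ≤ u + (1 + 1 / c) / u := by
    have : u + (1 + 1 / c) / u - (2 + 1 / c) = ((1 - u) ^ 2 + (1 - u) * (1 / c)) / u := by
      field_simp; ring
    have : 0 ≤ ((1 - u) ^ 2 + (1 - u) * (1 / c)) / u := by
      have : 0 ≤ 1 - u := by linarith
      positivity
    linarith
  have h2 : -(2 / (7 * c)) ≤ 1 / √c * (y - 1 / y) := by
    have h3 : -(2 / (7 * c)) ≤ y - 1 / y := by
      have : 1 / y ≤ 1 + 1 / (7 * c) := by
        rw [div_le_iff₀ hy0, hy]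
        have : (1 + 1 / (7 * c)) * (1 - 1 / (8 * c)) = 1 + (c - 1) / (56 * c ^ 2) := by
          field_simp; ring
        rw [this]
        have : 0 ≤ (c - 1) / (56 * c ^ 2) := div_nonneg (by linarith) (by positivity)
        linarith
      have h4 : 1 / (8 * c) ≤ 1 / (7 * c) := by gcongr; norm_num
      have h5 : 2 / (7 * c) = 1 / (7 * c) + 1 / (7 * c) := by ring
      linarith
    have h4 : y - 1 / y ≤ 0 := by
      have : 1 ≤ 1 / y := by rw [le_div_iff₀ hy0]; linarith
      linarith
    have h5 : 1 / √c ≤ 1 := by rw [div_le_one (by positivity)]; exact hsc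
    nlinarith
  have h3 : 2 / (7 * c) < 1 / c := by
    rw [div_lt_div_iff₀ (by positivity) (by positivity)]; linarith
  linarith

theorem exists_satFun_eq_zero {d : ℕ} (hd : 3 ≤ d) : ∃ x ∈ Set.Ioo (0 : ℝ) 1, satFun d x = 0 := by
  obtain ⟨y, hy, hyn⟩ := exists_satFun_neg hd
  obtain ⟨z, hz, hzp⟩ := exists_satFun_pos hd
  exact (isPreconnected_Ioo.intermediate_value hy hz (continuousOn_satFun hd)
    ⟨hyn.le, hzp.le⟩)

/-- Arithmetic–geometric mean with a free parameter; equality holds when u² a = b, so u selects the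
point of tangency. -/
theorem sqrt_mul_sqrt_le_tangent {a b u : ℝ} (hu : 0 < u) (ha : 0 ≤ a) (hb : 0 ≤ b) :
    √a * √b ≤ (u * a + b / u) / 2 := by
  obtain ⟨s, hs, rfl⟩ : ∃ s, 0 ≤ s ∧ a = s ^ 2 := ⟨√a, Real.sqrt_nonneg _, (Real.sq_sqrt ha).symm⟩
  obtain ⟨t, ht, rfl⟩ : ∃ s, 0 ≤ s ∧ b = s ^ 2 := ⟨√b, Real.sqrt_nonneg _, (Real.sq_sqrt hb).symm⟩
  rw [Real.sqrt_sq hs, Real.sqrt_sq ht]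
  have : (u * s ^ 2 + t ^ 2 / u) / 2 - s * t = (u * s - t) ^ 2 / (2 * u) := by field_simp; ring
  have : 0 ≤ (u * s - t) ^ 2 / (2 * u) := by positivity
  linarith

/-- The value at `0` of the tangent of `P ↦ leakBase d (P / 2)` at `P = x / (1 + x)`. -/
def tangentBase (d : ℕ) (x : ℝ) : ℝ :=
  (√(1 - x / ((d : ℝ) - 2)) + 1 / √(1 - x / ((d : ℝ) - 2))) / 2 + √x / (2 * √((d : ℝ) - 2))

/-- Both products of square roots are bounded by `sqrt_mul_sqrt_le_tangent`, with u = √(1 - x/c) and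
u = √x. Both bounds are tight at P = x/(1+x), and their slopes add up to `-satFun d x / 2`. This is
concavity without derivatives. -/
theorem leakBase_le_tangent {d : ℕ} (hd : 3 ≤ d) {x P : ℝ} (hx0 : 0 < x) (hx1 : x < 1)
    (hP : 0 ≤ P) (hP1 : P * (((d : ℝ) - 1) / ((d : ℝ) - 2)) ≤ 1) :
    leakBase d (P / 2) ≤ tangentBase d x - satFun d x / 2 * P := by
  have hd' : (3 : ℝ) ≤ d := by exact_mod_cast hd
  have hc : (1 : ℝ) ≤ (d : ℝ) - 2 := by linarith
  have hd1 : (d : ℝ) - 1 = ((d : ℝ) - 2) + 1 := by ring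
  rw [leakBase, tangentBase]
  rw [hd1] at hP1 ⊢
  have hw := one_sub_div_pos hc hx1
  rw [satFun_eq hw.le]
  set c := (d : ℝ) - 2 with hcdef
  have hc0 : 0 < c := by linarith
  have hPle : P ≤ 1 := by
    have : 1 ≤ (c + 1) / c := by rw [le_div_iff₀ hc0]; linarith
    nlinarith
  have hu : 0 < √(1 - x / c) := Real.sqrt_pos.2 hw
  have hsx : 0 < √x := Real.sqrt_pos.2 hx0
  have hsc : 0 < √c := Real.sqrt_pos.2 hc0
  rw [show 2 * (P / 2) = P by ring]
  have h1 := sqrt_mul_sqrt_le_tangent hu (a := 1 - P) (b := 1 - P * ((c + 1) / c))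
    (by linarith) (by linarith)
  have h2 := sqrt_mul_sqrt_le_tangent hsx (a := 1 - P) (b := P) (by linarith) hP
  generalize √(1 - x / c) = u at *
  generalize √x = y at *
  generalize √(1 - P) = s at *
  have h3 : s * (√P / √c) ≤ (y * (1 - P) + P / y) / 2 / √c := by
    rw [← mul_div_assoc]; gcongr
  have h4 : P + ((u * (1 - P) + (1 - P * ((c + 1) / c)) / u) / 2)
      + (y * (1 - P) + P / y) / 2 / √c
      = (u + 1 / u) / 2 + y / (2 * √c)
        - (u + (1 + 1 / c) / u + 1 / √c * (y - 1 / y) - 2) / 2 * P := by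
    field_simp
    ring
  rw [mul_add, ← h4]
  linarith

/-- The tangent touches the graph at P = x/(1+x): both uses of the arithmetic–geometric mean become
equalities there. -/
theorem leakBase_betaStar {d : ℕ} (hd : 3 ≤ d) {x : ℝ} (hx0 : 0 < x) (hx1 : x < 1) :
    leakBase d (betaStar x) = tangentBase d x - satFun d x / 2 * (x / (1 + x)) := by
  have hd' : (3 : ℝ) ≤ d := by exact_mod_cast hd
  have hc : (1 : ℝ) ≤ (d : ℝ) - 2 := by linarith
  have hd1 : (d : ℝ) - 1 = ((d : ℝ) - 2) + 1 := by ring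
  rw [leakBase, tangentBase, betaStar]
  rw [hd1]
  have hw := one_sub_div_pos hc hx1
  rw [satFun_eq hw.le]
  set c := (d : ℝ) - 2 with hcdef
  have hc0 : 0 < c := by linarith
  have hu : 0 < √(1 - x / c) := Real.sqrt_pos.2 hw
  have hsx : 0 < √x := Real.sqrt_pos.2 hx0
  have hsc : 0 < √c := Real.sqrt_pos.2 hc0
  have h1x : 0 < 1 + x := by linarith
  rw [show 2 * (x / 2 / (1 + x)) = x / (1 + x) by ring,
    show 1 - x / (1 + x) = 1 / (1 + x) by field_simp; ring,
    show 1 - x / (1 + x) * ((c + 1) / c) = (1 - x / c) / (1 + x) by field_simp; ring,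
    Real.sqrt_div hw.le, Real.sqrt_div hx0.le, Real.sqrt_div zero_le_one, Real.sqrt_one]
  have e1 : √x ^ 2 = x := Real.sq_sqrt hx0.le
  have e2 : √(1 - x / c) ^ 2 = 1 - x / c := Real.sq_sqrt hw.le
  have e3 : √(1 + x) ^ 2 = 1 + x := Real.sq_sqrt h1x.le
  have hs1 : 0 < √(1 + x) := Real.sqrt_pos.2 h1x
  have hl : x / (1 + x) + 1 / √(1 + x) * (√(1 - x / c) / √(1 + x) + √x / √(1 + x) / √c)
      = (x + √(1 - x / c) + √x / √c) / (1 + x) := by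
    rw [show 1 / √(1 + x) * (√(1 - x / c) / √(1 + x) + √x / √(1 + x) / √c)
      = (√(1 - x / c) + √x / √c) / √(1 + x) ^ 2 by field_simp, e3]
    ring
  rw [hl]
  generalize √(1 - x / c) = u at *
  generalize √x = y at *
  rw [div_eq_iff h1x.ne', sub_mul]
  rw [show (u + (1 + 1 / c) / u + 1 / √c * (y - 1 / y) - 2) / 2 * (x / (1 + x)) * (1 + x)
    = (u + (1 + 1 / c) / u + 1 / √c * (y - 1 / y) - 2) / 2 * x by field_simp]
  have e4 : u + 1 / u + x / u * (- (1 / c)) = 2 * u := by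
    have : u + 1 / u + x / u * (- (1 / c)) = u + (1 - x / c) / u := by ring
    rw [this, ← e2]; field_simp; ring
  have e5 : x / y = y := by rw [← e1]; field_simp
  have e6 : x * u = u * (y * y) := by rw [← e1]; ring
  have : ((u + 1 / u) / 2 + y / (2 * √c)) * (1 + x)
      - (u + (1 + 1 / c) / u + 1 / √c * (y - 1 / y) - 2) / 2 * x
      = x + (u + 1 / u + x / u * (- (1 / c))) / 2 + (y + x / y) / √c / 2 := by
    ring
  rw [this, e4, e5]
  ring

theorem leakBase_zero (d : ℕ) : leakBase d 0 = 1 := by simp [leakBase]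

theorem leakBase_nonneg {d : ℕ} {β : ℝ} (h : 0 ≤ β) : 0 ≤ leakBase d β := by
  unfold leakBase; positivity

theorem leakBase_pos {d : ℕ} {β : ℝ} (h : 0 ≤ β) : 0 < leakBase d β := by
  rcases h.eq_or_lt with rfl | h
  · rw [leakBase_zero]; exact one_pos
  · unfold leakBase; positivity

theorem betaStar_pos {x : ℝ} (hx : 0 < x) : 0 < betaStar x := by unfold betaStar; positivity

theorem leakT_pos {d : ℕ} {x β : ℝ} (hx : 0 < x) (hβ : 0 ≤ β) : 0 < leakT d (betaStar x) β := by
  unfold leakT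
  split_ifs
  · exact leakBase_pos hβ
  · exact leakBase_pos (betaStar_pos hx).le

/-- Apply y ≤ exp(y - 1) to y = f i / T; the exponents add up to at most 0. -/
theorem prod_le_pow_of_sum_le {n : ℕ} {f : Fin n → ℝ} {T : ℝ} (hT : 0 < T) (hf : ∀ i, 0 ≤ f i)
    (h : ∑ i, f i ≤ n * T) : ∏ i, f i ≤ T ^ n := by
  have h1 : ∀ i, f i ≤ T * Real.exp (f i / T - 1) := fun i => by
    have := Real.add_one_le_exp (f i / T - 1)
    calc f i = T * (f i / T - 1 + 1) := by field_simp; ring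
      _ ≤ _ := by gcongr
  calc ∏ i, f i ≤ ∏ i, T * Real.exp (f i / T - 1) :=
        Finset.prod_le_prod (fun i _ => hf i) fun i _ => h1 i
    _ = T ^ n * Real.exp (∑ i, (f i / T - 1)) := by
        rw [Finset.prod_mul_distrib, Real.exp_sum]; simp
    _ ≤ T ^ n * 1 := by
        gcongr
        rw [Real.exp_le_one_iff, Finset.sum_sub_distrib, ← Finset.sum_div]
        simp only [Finset.sum_const, Finset.card_univ, Fintype.card_fin, nsmul_eq_mul, mul_one]
        rw [sub_nonpos, div_le_iff₀ hT]
        exact h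
    _ = T ^ n := mul_one _

/-- It suffices to bound the sum of the leakages. Below saturation the tangent at P = 2β has
nonnegative slope, so the bound on ∑ P i can be inserted. Above saturation the tangent at P =
x/(1+x) is horizontal and bounds each round separately. -/
theorem prod_leakBase_le {d : ℕ} (hd : 3 ≤ d) {x : ℝ} (hx : x ∈ Set.Ioo (0 : ℝ) 1)
    (hsat : satFun d x = 0) {n : ℕ} {β : ℝ} (hβ : 0 ≤ β) {P : Fin n → ℝ} (hP : ∀ i, 0 ≤ P i)
    (hP1 : ∀ i, P i * (((d : ℝ) - 1) / ((d : ℝ) - 2)) ≤ 1) (hsum : ∑ i, P i ≤ n * (2 * β)) :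
    ∏ i, leakBase d (P i / 2) ≤ leakT d (betaStar x) β ^ n := by
  have hnn : ∀ i, 0 ≤ leakBase d (P i / 2) := fun i => leakBase_nonneg (by have := hP i; linarith)
  refine prod_le_pow_of_sum_le (leakT_pos hx.1 hβ) hnn ?_
  unfold leakT
  split_ifs with h
  -- At β = 0 the tangent would be vertical because of √(2β); but then every P i vanishes.
  · rcases hβ.eq_or_lt with rfl | hβ0
    · have h0 : ∀ i, P i = 0 := by
        have : ∑ i, P i = 0 := le_antisymm (by simpa using hsum) (Finset.sum_nonneg fun i _ => hP i)
        exact fun i => (Finset.sum_eq_zero_iff_of_nonneg fun i _ => hP i).1 this i (Finset.mem_univ i)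
      simp [h0, leakBase_zero]
    have h1x : 0 < 1 + x := by linarith [hx.1]
    have hβx : 2 * β ≤ x / (1 + x) := by
      rw [betaStar] at h
      calc 2 * β ≤ 2 * (x / 2 / (1 + x)) := by linarith
        _ = _ := by ring
    have hβ1 : 2 * β < 1 := hβx.trans_lt (by rw [div_lt_one h1x]; linarith)
    have h1β : 0 < 1 - 2 * β := by linarith
    -- The parameter with y/(1+y) = 2β, so that the tangent for y touches at P = 2β.
    set y := 2 * β / (1 - 2 * β) with hy
    have hy0 : 0 < y := by positivity
    have hyx : y ≤ x := by
      rw [hy, div_le_iff₀ h1β]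
      rw [le_div_iff₀ h1x] at hβx
      linarith
    have hy1 : y < 1 := hyx.trans_lt hx.2
    have hyP : y / (1 + y) = 2 * β := by rw [hy]; field_simp; ring
    have hyβ : betaStar y = β := by
      have : betaStar y = y / (1 + y) / 2 := by unfold betaStar; ring
      rw [this, hyP]; ring
    have hsy : satFun d y ≤ 0 := by
      rw [← hsat]; exact (satFun_strictMonoOn hd).monotoneOn ⟨hy0, hy1⟩ hx hyx
    have key := leakBase_betaStar hd hy0 hy1
    rw [hyβ, hyP] at key
    calc ∑ i, leakBase d (P i / 2) ≤ ∑ i, (tangentBase d y - satFun d y / 2 * P i) :=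
          Finset.sum_le_sum fun i _ => leakBase_le_tangent hd hy0 hy1 (hP i) (hP1 i)
      _ = n * tangentBase d y - satFun d y / 2 * ∑ i, P i := by
          rw [Finset.sum_sub_distrib, ← Finset.mul_sum]; simp
      _ ≤ n * tangentBase d y - satFun d y / 2 * (n * (2 * β)) := by
          have := mul_le_mul_of_nonneg_left hsum (show 0 ≤ -(satFun d y / 2) by linarith)
          linarith
      _ = n * leakBase d β := by rw [key]; ring
  · have key := leakBase_betaStar hd hx.1 hx.2
    rw [hsat] at key
    calc ∑ i, leakBase d (P i / 2) ≤ ∑ i : Fin n, leakBase d (betaStar x) :=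
          Finset.sum_le_sum fun i _ => by
            have := leakBase_le_tangent hd hx.1 hx.2 (hP i) (hP1 i)
            rw [hsat] at this
            rw [key]; simpa using this
      _ = _ := by simp

/-! ### A weighted Cauchy–Schwarz bound for the trace norm -/

/-- A Hermitian matrix has a Hermitian unitary sign. -/
theorem exists_sign {ι : Type*} [Fintype ι] [DecidableEq ι] {X : Matrix ι ι ℂ}
    (hX : X.IsHermitian) :
    ∃ U : Matrix ι ι ℂ, U.IsHermitian ∧ U * U = 1 ∧ cfc Real.sqrt (X.conjTranspose * X) = U * X := by
  have hsa : IsSelfAdjoint X := hX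
  have hfin : (spectrum ℝ X).Finite := Matrix.finite_real_spectrum
  have hc : ∀ f : ℝ → ℝ, ContinuousOn f (spectrum ℝ X) := fun f => hfin.continuousOn f
  -- The value 1 instead of 0 at t = 0 gives f² = 1, hence U² = 1 even for singular X.
  set f : ℝ → ℝ := fun t => if t < 0 then -1 else 1 with hf
  refine ⟨cfc f X, cfc_predicate f X, ?_, ?_⟩
  · rw [← cfc_mul f f X (hc _) (hc _)]
    have : (fun t => f t * f t) = fun _ => (1 : ℝ) := by
      funext t; simp only [hf]; split_ifs <;> norm_num
    rw [this, cfc_const_one ℝ X]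
  · have h1 : X.conjTranspose * X = cfc (fun t : ℝ => t * t) X := by
      rw [cfc_mul (fun t : ℝ => t) (fun t => t) X (hc _) (hc _), cfc_id' ℝ X, hX.eq]
    have h2 : cfc Real.sqrt (cfc (fun t : ℝ => t * t) X) = cfc (fun t : ℝ => √(t * t)) X := by
      rw [← cfc_comp' Real.sqrt (fun t : ℝ => t * t) X (by fun_prop) (hc _)]
    rw [h1, h2]
    have h3 : (fun t : ℝ => √(t * t)) = fun t => f t * t := by
      funext t
      rw [Real.sqrt_mul_self_eq_abs]
      simp only [hf]
      split_ifs with h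
      · rw [abs_of_neg h]; ring
      · rw [abs_of_nonneg (not_lt.1 h)]; ring
    rw [h3, cfc_mul f (fun t : ℝ => t) X (hc _) (hc _), cfc_id' ℝ X]

/-- The squared Hilbert–Schmidt norm of the commutator HU - UH is nonnegative. -/
theorem trace_mul_conj_le {ι : Type*} [Fintype ι] [DecidableEq ι] {H U : Matrix ι ι ℂ}
    (hH : H.IsHermitian) (hU : U.IsHermitian) (hUU : U * U = 1) :
    (H * U * H * U).trace.re ≤ (H * H).trace.re := by
  set Z := H * U - U * H with hZ
  have hpos : 0 ≤ (Z.conjTranspose * Z).trace.re := by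
    have := (Matrix.posSemidef_conjTranspose_mul_self Z).trace_nonneg
    exact (Complex.le_def.1 this).1
  have hexp : (Z.conjTranspose * Z).trace = 2 * (H * H).trace - 2 * (H * U * H * U).trace := by
    have hZc : Z.conjTranspose = U * H - H * U := by
      rw [hZ, Matrix.conjTranspose_sub, Matrix.conjTranspose_mul, Matrix.conjTranspose_mul,
        hH.eq, hU.eq]
    have e1 : (U * H * (H * U)).trace = (H * H).trace := by
      rw [Matrix.trace_mul_comm]
      rw [show H * U * (U * H) = H * (U * U) * H by noncomm_ring, hUU, mul_one]
    have e2 : (H * U * (U * H)).trace = (H * H).trace := by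
      rw [show H * U * (U * H) = H * (U * U) * H by noncomm_ring, hUU, mul_one]
    have e3 : (U * H * (U * H)).trace = (H * U * H * U).trace := by
      rw [show U * H * (U * H) = U * (H * U * H) by noncomm_ring, Matrix.trace_mul_comm]
    have e4 : (H * U * (H * U)).trace = (H * U * H * U).trace := by noncomm_ring
    rw [hZc, hZ, sub_mul, mul_sub, mul_sub, Matrix.trace_sub, Matrix.trace_sub, Matrix.trace_sub,
      e1, e2, e3, e4]
    ring
  rw [hexp] at hpos
  simp at hpos
  linarith

/-- With U the sign of X = V O V†, the trace norm is tr(UX) = ∑ B_ji O_ij for B = V† U V.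
Cauchy–Schwarz with weights w_i w_j splits off the quadratic form in O, and the part with B no
longer depends on U once `trace_mul_conj_le` is applied. -/
theorem traceNorm_le_of_factor {ι κ : Type*} [Fintype ι] [DecidableEq ι] [Fintype κ]
    [DecidableEq κ] {V : Matrix ι κ ℂ} {D w : κ → ℝ} {O : Matrix κ κ ℂ}
    (hV : V.conjTranspose * V = Matrix.diagonal fun j => (D j : ℂ))
    (hO : O.IsHermitian) (hw : ∀ j, 0 ≤ w j) (hwD : ∀ j, w j = 0 → D j = 0) :
    traceNorm (V * O * V.conjTranspose) ≤
      √((∑ j, (D j / w j) ^ 2) * ∑ i, ∑ j, w i * w j * ‖O i j‖ ^ 2) := by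
  set X := V * O * V.conjTranspose with hXdef
  have hX : X.IsHermitian := by
    rw [Matrix.IsHermitian, hXdef]
    simp only [Matrix.conjTranspose_mul, Matrix.conjTranspose_conjTranspose, hO.eq, Matrix.mul_assoc]
  obtain ⟨U, hU, hUU, hsign⟩ := exists_sign hX
  set B := V.conjTranspose * U * V with hB
  have hBh : B.IsHermitian := by
    rw [Matrix.IsHermitian, hB]
    simp only [Matrix.conjTranspose_mul, Matrix.conjTranspose_conjTranspose, hU.eq, Matrix.mul_assoc]
  -- Division by zero yields 0, so labels of weight zero must carry no mass: their columns of V have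
  -- squared norm D j = 0.
  have hcol : ∀ j, w j = 0 → ∀ e, V e j = 0 := by
    intro j hj e
    have h1 := congrFun (congrFun hV j) j
    rw [Matrix.diagonal_apply_eq, hwD j hj, Matrix.mul_apply] at h1
    have h2 : ∑ e, ‖V e j‖ ^ 2 = 0 := by
      have : ((∑ e, ‖V e j‖ ^ 2 : ℝ) : ℂ) = 0 := by
        rw [Complex.ofReal_zero] at h1
        rw [← h1]
        push_cast
        refine Finset.sum_congr rfl fun e _ => ?_
        rw [Matrix.conjTranspose_apply, Complex.star_def, Complex.conj_mul']
      exact_mod_cast this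
    have h3 := (Finset.sum_eq_zero_iff_of_nonneg fun e _ => by positivity).1 h2 e (Finset.mem_univ e)
    simpa using h3
  have hB0 : ∀ i j, w i = 0 ∨ w j = 0 → B i j = 0 := by
    rintro i j (h | h)
    · rw [hB, Matrix.mul_assoc, Matrix.mul_apply]
      exact Finset.sum_eq_zero fun e _ => by simp [hcol i h e]
    · rw [hB, Matrix.mul_apply]
      exact Finset.sum_eq_zero fun e _ => by simp [hcol j h e]
  have htr : traceNorm X = (∑ i, ∑ j, B j i * O i j).re := by
    rw [traceNorm, hsign, hXdef]
    rw [show U * (V * O * V.conjTranspose) = U * V * O * V.conjTranspose by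
      simp only [Matrix.mul_assoc], Matrix.trace_mul_comm,
      show V.conjTranspose * (U * V * O) = B * O by rw [hB]; simp only [Matrix.mul_assoc],
      Matrix.trace_mul_comm]
    simp [Matrix.trace, Matrix.mul_apply, mul_comm]
  -- The left side is tr(W B W B) = tr(H U H U) with W = diag(1/w) and H = V W V†, whereas tr(H²) =
  -- ∑ (D j / w j)².
  have hfirst : ∑ i, ∑ j, ‖B j i‖ ^ 2 / (w i * w j) ≤ ∑ j, (D j / w j) ^ 2 := by
    set W : Matrix κ κ ℂ := Matrix.diagonal fun j => ((w j)⁻¹ : ℂ) with hW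
    have hWh : W.conjTranspose = W := by
      rw [hW, Matrix.diagonal_conjTranspose]
      congr 1; funext j; simp
    set H := V * W * V.conjTranspose with hHdef
    have hH : H.IsHermitian := by
      rw [Matrix.IsHermitian, hHdef]
      simp only [Matrix.conjTranspose_mul, Matrix.conjTranspose_conjTranspose, hWh, Matrix.mul_assoc]
    have h := trace_mul_conj_le hH hU hUU
    have e1 : (H * U * H * U).trace = (W * B * (W * B)).trace := by
      rw [show H * U * H * U = V * (W * B * W * V.conjTranspose * U) by
        rw [hHdef, hB]; simp only [Matrix.mul_assoc], Matrix.trace_mul_comm]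
      rw [hB]; simp only [Matrix.mul_assoc]
    have e2 : (H * H).trace = (W * (V.conjTranspose * V) * (W * (V.conjTranspose * V))).trace := by
      rw [show H * H = V * (W * (V.conjTranspose * V) * W * V.conjTranspose) by
        rw [hHdef]; simp only [Matrix.mul_assoc], Matrix.trace_mul_comm]
      simp only [Matrix.mul_assoc]
    rw [e1, e2, hV, hW, Matrix.diagonal_mul_diagonal, Matrix.diagonal_mul_diagonal,
      Matrix.trace_diagonal] at h
    have e3 : (∑ j, ((w j : ℂ)⁻¹ * D j) * ((w j : ℂ)⁻¹ * D j)).re = ∑ j, (D j / w j) ^ 2 := by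
      rw [← Complex.ofReal_re (∑ j, (D j / w j) ^ 2)]
      push_cast
      congr 1
      exact Finset.sum_congr rfl fun j _ => by ring
    have e4 : (Matrix.diagonal (fun j => ((w j)⁻¹ : ℂ)) * B *
        (Matrix.diagonal (fun j => ((w j)⁻¹ : ℂ)) * B)).trace.re
        = ∑ i, ∑ j, ‖B j i‖ ^ 2 / (w i * w j) := by
      rw [← Complex.ofReal_re (∑ i, ∑ j, ‖B j i‖ ^ 2 / (w i * w j))]
      push_cast
      congr 1
      rw [Matrix.trace]
      refine Finset.sum_congr rfl fun i _ => ?_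
      rw [Matrix.diag_apply, Matrix.mul_apply]
      refine Finset.sum_congr rfl fun j _ => ?_
      rw [Matrix.diagonal_mul, Matrix.diagonal_mul]
      have : B i j = (starRingEnd ℂ) (B j i) := by
        conv_lhs => rw [← hBh.eq]
        rfl
      rw [this, ← Complex.conj_mul']
      ring
    rw [e3, e4] at h
    exact h
  rw [htr]
  calc (∑ i, ∑ j, B j i * O i j).re ≤ ‖∑ i, ∑ j, B j i * O i j‖ := Complex.re_le_norm _
    _ ≤ ∑ i, ∑ j, ‖B j i‖ * ‖O i j‖ :=
        (norm_sum_le _ _).trans (Finset.sum_le_sum fun i _ => (norm_sum_le _ _).trans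
          (Finset.sum_le_sum fun j _ => (norm_mul _ _).le))
    _ = ∑ q : κ × κ, (‖B q.2 q.1‖ / √(w q.1 * w q.2)) * (√(w q.1 * w q.2) * ‖O q.1 q.2‖) := by
        rw [← Finset.univ_product_univ, Finset.sum_product]
        refine Finset.sum_congr rfl fun i _ => Finset.sum_congr rfl fun j _ => ?_
        by_cases h : w j = 0 ∨ w i = 0
        · simp [hB0 j i h]
        · push Not at h
          have h1 : 0 < w i * w j :=
            mul_pos ((hw i).lt_of_ne h.2.symm) ((hw j).lt_of_ne h.1.symm)
          have := Real.sqrt_pos.2 h1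
          simp only
          field_simp
    _ ≤ √(∑ q : κ × κ, (‖B q.2 q.1‖ / √(w q.1 * w q.2)) ^ 2) *
          √(∑ q : κ × κ, (√(w q.1 * w q.2) * ‖O q.1 q.2‖) ^ 2) := Real.sum_mul_le_sqrt_mul_sqrt _ _ _
    _ = √((∑ i, ∑ j, ‖B j i‖ ^ 2 / (w i * w j)) * ∑ i, ∑ j, w i * w j * ‖O i j‖ ^ 2) := by
        have hww : ∀ i j, √(w i * w j) ^ 2 = w i * w j := fun i j =>
          Real.sq_sqrt (mul_nonneg (hw i) (hw j))
        rw [← Real.sqrt_mul (Finset.sum_nonneg fun q _ => sq_nonneg _)]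
        simp_rw [← Finset.univ_product_univ, Finset.sum_product, div_pow, mul_pow, hww]
    _ ≤ _ := by
        apply Real.sqrt_le_sqrt
        refine mul_le_mul_of_nonneg_right hfirst ?_
        exact Finset.sum_nonneg fun i _ => Finset.sum_nonneg fun j _ =>
          mul_nonneg (mul_nonneg (hw i) (hw j)) (sq_nonneg _)

/-! ### Tensor products of finite families of rectangular matrices -/

/-- The tensor product of a finite family of rectangular matrices. -/
def tensorRect {n : ℕ} {ε κ : Fin n → Type*} (A : ∀ i, Matrix (ε i) (κ i) ℂ) :
    Matrix (∀ i, ε i) (∀ i, κ i) ℂ :=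
  Matrix.of fun e j => ∏ i, A i (e i) (j i)

theorem tensorRect_mul {n : ℕ} {ε κ θ : Fin n → Type*} [∀ i, Fintype (κ i)]
    [∀ i, DecidableEq (κ i)]
    (A : ∀ i, Matrix (ε i) (κ i) ℂ) (B : ∀ i, Matrix (κ i) (θ i) ℂ) :
    tensorRect (fun i => A i * B i) = tensorRect A * tensorRect B := by
  ext e j
  simp only [tensorRect, Matrix.of_apply, Matrix.mul_apply, Finset.prod_univ_sum,
    Fintype.piFinset_univ, Finset.prod_mul_distrib]

theorem tensorRect_conjTranspose {n : ℕ} {ε κ : Fin n → Type*}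
    (A : ∀ i, Matrix (ε i) (κ i) ℂ) :
    (tensorRect A).conjTranspose = tensorRect fun i => (A i).conjTranspose := by
  ext e j
  simp [tensorRect, Matrix.conjTranspose_apply]

theorem tensorRect_diagonal {n : ℕ} {κ : Fin n → Type*} [∀ i, DecidableEq (κ i)]
    (D : ∀ i, κ i → ℂ) :
    tensorRect (fun i => Matrix.diagonal (D i)) = Matrix.diagonal fun j => ∏ i, D i (j i) := by
  ext e j
  simp only [tensorRect, Matrix.of_apply, Matrix.diagonal_apply]
  split_ifs with h
  · subst h; simp
  · obtain ⟨i, hi⟩ := Function.ne_iff.1 h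
    exact Finset.prod_eq_zero (Finset.mem_univ i) (by simp [hi])

theorem prod_sum_sum {n : ℕ} {κ : Type*} [Fintype κ] [DecidableEq κ] (f : Fin n → κ → κ → ℝ) :
    ∏ i, ∑ a, ∑ b, f i a b = ∑ a : Fin n → κ, ∑ b : Fin n → κ, ∏ i, f i (a i) (b i) := by
  simp only [Finset.prod_univ_sum, Fintype.piFinset_univ]

/-! ### The trace norm of classical-quantum operators -/

theorem cqState_apply {α ε : Type*} [Fintype α] [DecidableEq α] (ω : α → Matrix ε ε ℂ)
    (a b : α) (e f : ε) :
    cqState ω (a, e) (b, f) = (1 / (Fintype.card α : ℂ)) * if a = b then ω a e f else 0 := by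
  simp only [cqState, Matrix.smul_apply, Matrix.sum_apply, Matrix.kroneckerMap_apply, smul_eq_mul]
  congr 1
  rw [Finset.sum_eq_single a]
  · simp [Matrix.single_apply]
  · intro c _ hc; simp [hc]
  · simp

theorem cqState_sub {α ε : Type*} [Fintype α] [DecidableEq α] (ω ω' : α → Matrix ε ε ℂ) :
    cqState ω - cqState ω' = cqState fun a => ω a - ω' a := by
  ext ⟨a, e⟩ ⟨b, f⟩
  simp only [Matrix.sub_apply, cqState_apply]
  split_ifs <;> ring

theorem cqState_factor {α ε κ : Type*} [Fintype α] [DecidableEq α] [Fintype κ]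
    (V : Matrix ε κ ℂ) (O : α → Matrix κ κ ℂ) :
    cqState (fun a => V * O a * V.conjTranspose) =
      ((1 : Matrix α α ℂ) ⊗ₖ V) * cqState O * ((1 : Matrix α α ℂ) ⊗ₖ V).conjTranspose := by
  simp only [cqState, Matrix.conjTranspose_kronecker, Matrix.conjTranspose_one, Matrix.mul_smul,
    Matrix.smul_mul, Matrix.mul_sum, Matrix.sum_mul, ← Matrix.mul_kronecker_mul, one_mul, mul_one]

theorem cqState_isHermitian {α κ : Type*} [Fintype α] [DecidableEq α]
    {O : α → Matrix κ κ ℂ} (hO : ∀ a, (O a).IsHermitian) : (cqState O).IsHermitian := by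
  ext ⟨a, e⟩ ⟨b, f⟩
  simp only [Matrix.conjTranspose_apply, cqState_apply]
  by_cases h : a = b
  · subst h
    have := congrFun (congrFun (hO a) e) f
    rw [Matrix.conjTranspose_apply] at this
    simp [← this]
  · simp [h, Ne.symm h]

/-- Apply the bound to 1 ⊗ V. The squared norms are repeated |α| times and the coefficients carry
1/|α|², which leaves an average over α. -/
theorem traceNorm_cqState_le {α ε κ : Type*} [Fintype α] [DecidableEq α] [Nonempty α] [Fintype ε]
    [DecidableEq ε] [Fintype κ] [DecidableEq κ] {V : Matrix ε κ ℂ} {D w : κ → ℝ}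
    {O : α → Matrix κ κ ℂ}
    (hV : V.conjTranspose * V = Matrix.diagonal fun j => (D j : ℂ))
    (hO : ∀ a, (O a).IsHermitian) (hw : ∀ j, 0 ≤ w j) (hwD : ∀ j, w j = 0 → D j = 0) :
    traceNorm (cqState fun a => V * O a * V.conjTranspose) ≤
      √((∑ j, (D j / w j) ^ 2) *
        (1 / Fintype.card α * ∑ a, ∑ i, ∑ j, w i * w j * ‖O a i j‖ ^ 2)) := by
  rw [cqState_factor]
  refine (traceNorm_le_of_factor (D := fun q : α × κ => D q.2) (w := fun q => w q.2) ?_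
    (cqState_isHermitian hO) (fun q => hw q.2) fun q => hwD q.2).trans (Real.sqrt_le_sqrt ?_)
  · rw [Matrix.conjTranspose_kronecker, ← Matrix.mul_kronecker_mul, hV, Matrix.conjTranspose_one,
      one_mul, ← Matrix.diagonal_one, Matrix.diagonal_kronecker_diagonal]
    simp
  · have hα : (Fintype.card α : ℝ) ≠ 0 := by simp
    have e1 : ∑ q : α × κ, (D q.2 / w q.2) ^ 2 = Fintype.card α * ∑ j, (D j / w j) ^ 2 := by
      rw [Fintype.sum_prod_type]; simp
    have e2 : ∑ p : α × κ, ∑ q : α × κ, w p.2 * w q.2 * ‖cqState O p q‖ ^ 2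
        = 1 / (Fintype.card α : ℝ) ^ 2 * ∑ a, ∑ i, ∑ j, w i * w j * ‖O a i j‖ ^ 2 := by
      rw [Fintype.sum_prod_type, Finset.mul_sum]
      refine Finset.sum_congr rfl fun a _ => ?_
      rw [Finset.mul_sum]
      refine Finset.sum_congr rfl fun i _ => ?_
      rw [Fintype.sum_prod_type, Finset.sum_eq_single a]
      · rw [Finset.mul_sum]
        refine Finset.sum_congr rfl fun j _ => ?_
        rw [cqState_apply, if_pos rfl, norm_mul, norm_div]
        simp only [norm_one, RCLike.norm_natCast]
        ring
      · intro b _ hb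
        exact Finset.sum_eq_zero fun j _ => by rw [cqState_apply, if_neg hb.symm]; simp
      · simp
    rw [e1, e2]
    refine le_of_eq ?_
    field_simp

/-! ### Leftover hashing against orthogonally factored ancilla states -/

/-- Ancilla states `σ s` that are real combinations of orthogonal vectors `V j` with squared norms
`D j`, with weights `w` that witness the distinguishing factor `T`. -/
structure RoundFactor {ε : Type*} [Fintype ε] (κ : Type) [Fintype κ] [DecidableEq κ]
    (σ : Bool → Matrix ε ε ℂ) (T : ℝ) where
  V : Matrix ε κ ℂ
  D : κ → ℝ
  w : κ → ℝ
  o : Bool → κ → κ → ℝ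
  gram : V.conjTranspose * V = Matrix.diagonal fun j => (D j : ℂ)
  o_symm : ∀ s i j, o s i j = o s j i
  w_nonneg : ∀ j, 0 ≤ w j
  D_eq_zero : ∀ j, w j = 0 → D j = 0
  eq_factor : ∀ s, σ s = V * (Matrix.of fun i j => (o s i j : ℂ)) * V.conjTranspose
  cross_nonneg : ∀ s s', 0 ≤ ∑ i, ∑ j, w i * w j * (o s i j * o s' i j)
  bound : ∀ s, (∑ j, (D j / w j) ^ 2) * ∑ i, ∑ j, w i * w j * (o s i j * o s i j) ≤ T ^ 2

/-- Up to scale, this is the covariance of the indicators of Ext x = z and Ext y = z. Summing over z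
gives collision probability minus 2^{-ℓ}, which universality makes nonpositive unless x = y. -/
theorem sum_hash_mul_hash {n ℓ : ℕ} {υ : Type*} [Fintype υ] [Nonempty υ]
    {Ext : (Fin n → Bool) → υ → (Fin ℓ → Bool)} (hExt : IsUniversalHash Ext)
    (x y : Fin n → Bool) :
    1 / (Fintype.card ((Fin ℓ → Bool) × υ) : ℝ) * ∑ p : (Fin ℓ → Bool) × υ,
      ((2 : ℝ) ^ ℓ / 2 ^ n * ((if Ext x p.2 = p.1 then 1 else 0) - 1 / 2 ^ ℓ)) *
        ((2 : ℝ) ^ ℓ / 2 ^ n * ((if Ext y p.2 = p.1 then 1 else 0) - 1 / 2 ^ ℓ))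
      ≤ if x = y then ((2 : ℝ) ^ ℓ - 1) / (2 ^ n) ^ 2 else 0 := by
  have hυ : (Fintype.card υ : ℝ) ≠ 0 := by simp
  have h1 : ∀ u, ∑ z : Fin ℓ → Bool,
      ((2 : ℝ) ^ ℓ / 2 ^ n * ((if Ext x u = z then 1 else 0) - 1 / 2 ^ ℓ)) *
        ((2 : ℝ) ^ ℓ / 2 ^ n * ((if Ext y u = z then 1 else 0) - 1 / 2 ^ ℓ))
      = ((2 : ℝ) ^ ℓ / 2 ^ n) ^ 2 * ((if Ext x u = Ext y u then 1 else 0) - 1 / 2 ^ ℓ) := by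
    intro u
    have : ∀ z : Fin ℓ → Bool,
        ((2 : ℝ) ^ ℓ / 2 ^ n * ((if Ext x u = z then 1 else 0) - 1 / 2 ^ ℓ)) *
        ((2 : ℝ) ^ ℓ / 2 ^ n * ((if Ext y u = z then 1 else 0) - 1 / 2 ^ ℓ))
        = ((2 : ℝ) ^ ℓ / 2 ^ n) ^ 2 * ((if Ext x u = z then (if Ext y u = z then 1 else 0) else 0)
          - 1 / 2 ^ ℓ * (if Ext x u = z then 1 else 0)
          - 1 / 2 ^ ℓ * (if Ext y u = z then 1 else 0) + 1 / 2 ^ ℓ * (1 / 2 ^ ℓ)) := by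
      intro z; split_ifs <;> ring
    simp_rw [this]
    rw [← Finset.mul_sum, Finset.sum_add_distrib, Finset.sum_sub_distrib, Finset.sum_sub_distrib,
      ← Finset.mul_sum, ← Finset.mul_sum, Finset.sum_ite_eq, Finset.sum_ite_eq, Finset.sum_ite_eq]
    have h2 : (2 : ℝ) ^ ℓ * ((2 ^ ℓ)⁻¹ * (2 ^ ℓ)⁻¹) = (2 ^ ℓ)⁻¹ := by field_simp
    simp [eq_comm, h2]
  rw [Fintype.sum_prod_type_right]
  simp_rw [h1]
  rw [← Finset.mul_sum, Finset.sum_sub_distrib, Finset.sum_boole]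
  have hcard : (Fintype.card ((Fin ℓ → Bool) × υ) : ℝ) = 2 ^ ℓ * Fintype.card υ := by simp
  rw [hcard]
  have h2 : 1 / ((2 : ℝ) ^ ℓ * Fintype.card υ) * (((2 : ℝ) ^ ℓ / 2 ^ n) ^ 2 *
      (((Finset.univ.filter fun u => Ext x u = Ext y u).card : ℝ) - ∑ _u : υ, 1 / 2 ^ ℓ))
      = (2 ^ ℓ / (2 ^ n) ^ 2) *
        ((Finset.univ.filter fun u => Ext x u = Ext y u).card / Fintype.card υ - 1 / 2 ^ ℓ) := by
    simp only [Finset.sum_const, Finset.card_univ, nsmul_eq_mul]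
    field_simp
  rw [h2]
  split_ifs with h
  · subst h
    simp only [Finset.filter_true, Finset.card_univ]
    refine le_of_eq ?_
    field_simp
  · exact mul_nonpos_of_nonneg_of_nonpos (by positivity) (sub_nonpos.2 (hExt x y h))

theorem hash_sub_average {n ℓ : ℕ} {υ ε : Type*} (Ext : (Fin n → Bool) → υ → (Fin ℓ → Bool))
    (S : (Fin n → Bool) → Matrix ε ε ℂ) (z : Fin ℓ → Bool) (u : υ) :
    (((2 : ℂ) ^ ℓ / 2 ^ n) • ∑ x, if Ext x u = z then S x else 0)
      - (1 / (Fintype.card (Fin ℓ → Bool) : ℂ)) • ∑ z' : Fin ℓ → Bool,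
        (((2 : ℂ) ^ ℓ / 2 ^ n) • ∑ x, if Ext x u = z' then S x else 0)
    = ∑ x, (((2 : ℝ) ^ ℓ / 2 ^ n * ((if Ext x u = z then 1 else 0) - 1 / 2 ^ ℓ) : ℝ) : ℂ) • S x := by
  have h1 : ∑ z' : Fin ℓ → Bool, (((2 : ℂ) ^ ℓ / 2 ^ n) • ∑ x, if Ext x u = z' then S x else 0)
      = ((2 : ℂ) ^ ℓ / 2 ^ n) • ∑ x, S x := by
    rw [← Finset.smul_sum, Finset.sum_comm]
    simp
  rw [h1, smul_smul, Finset.smul_sum, Finset.smul_sum, ← Finset.sum_sub_distrib]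
  refine Finset.sum_congr rfl fun x _ => ?_
  split_ifs
  · rw [← sub_smul]
    congr 1
    push_cast
    simp
    ring
  · rw [smul_zero, zero_sub, ← neg_smul]
    congr 1
    push_cast
    simp
    ring

/-- The factorisations of the single rounds tensor to one common V for all x, so the deviation from
uniformity is V O V† with O linear in the centred hash indicators. Norms, weights and kernels are
products over the rounds. -/
theorem distFromUniform_le {n ℓ : ℕ} {υ : Type*} [Fintype υ] [DecidableEq υ] [Nonempty υ]
    {Ext : (Fin n → Bool) → υ → (Fin ℓ → Bool)} (hExt : IsUniversalHash Ext)
    {ε : Fin n → Type*} [∀ i, Fintype (ε i)] [∀ i, DecidableEq (ε i)]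
    {κ : Type} [Fintype κ] [DecidableEq κ]
    {σ : ∀ i, Bool → Matrix (ε i) (ε i) ℂ} {T : Fin n → ℝ}
    (R : ∀ i, RoundFactor κ (σ i) (T i)) :
    distFromUniform (fun z u => (((2 : ℂ) ^ ℓ / 2 ^ n) • ∑ x : Fin n → Bool,
      if Ext x u = z then tensorFamily (fun i => σ i (x i)) else 0)) ≤
      1 / 2 * √(((2 : ℝ) ^ ℓ - 1) / 2 ^ n * (∏ i, T i) ^ 2) := by
  set V : Matrix (∀ i, ε i) (Fin n → κ) ℂ := tensorRect fun i => (R i).V with hVdef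
  set D : (Fin n → κ) → ℝ := fun j => ∏ i, (R i).D (j i) with hD
  set w : (Fin n → κ) → ℝ := fun j => ∏ i, (R i).w (j i) with hw
  set o : (Fin n → Bool) → (Fin n → κ) → (Fin n → κ) → ℝ :=
    fun x a b => ∏ i, (R i).o (x i) (a i) (b i) with ho
  have hV : V.conjTranspose * V = Matrix.diagonal fun j => (D j : ℂ) := by
    rw [hVdef, tensorRect_conjTranspose, ← tensorRect_mul]
    simp_rw [(R _).gram]
    rw [tensorRect_diagonal]
    simp [hD]
  have hfac : ∀ x : Fin n → Bool, tensorFamily (fun i => σ i (x i))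
      = V * (Matrix.of fun a b => (o x a b : ℂ)) * V.conjTranspose := by
    intro x
    have h1 : (Matrix.of fun a b => (o x a b : ℂ)) =
        tensorRect fun i => (Matrix.of fun a b => ((R i).o (x i) a b : ℂ)) := by
      ext a b; simp [tensorRect, ho]
    rw [h1, hVdef, tensorRect_conjTranspose, ← tensorRect_mul, ← tensorRect_mul]
    simp_rw [← (R _).eq_factor]
    rfl
  set g : (Fin n → Bool) → (Fin ℓ → Bool) × υ → ℝ := fun x p =>
    (2 : ℝ) ^ ℓ / 2 ^ n * ((if Ext x p.2 = p.1 then 1 else 0) - 1 / 2 ^ ℓ) with hg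
  set O : (Fin ℓ → Bool) × υ → Matrix (Fin n → κ) (Fin n → κ) ℂ := fun p =>
    Matrix.of fun a b => ((∑ x, g x p * o x a b : ℝ) : ℂ) with hO
  have hOapp : ∀ p a b, O p a b = ((∑ x, g x p * o x a b : ℝ) : ℂ) := fun _ _ _ => rfl
  have hdist : (fun p : (Fin ℓ → Bool) × υ => (((2 : ℂ) ^ ℓ / 2 ^ n) • ∑ x : Fin n → Bool,
        if Ext x p.2 = p.1 then tensorFamily (fun i => σ i (x i)) else 0)
      - (1 / (Fintype.card (Fin ℓ → Bool) : ℂ)) • ∑ z' : Fin ℓ → Bool,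
        (((2 : ℂ) ^ ℓ / 2 ^ n) • ∑ x : Fin n → Bool,
          if Ext x p.2 = z' then tensorFamily (fun i => σ i (x i)) else 0))
      = fun p => V * O p * V.conjTranspose := by
    funext p
    rw [hash_sub_average Ext (fun x : Fin n → Bool => tensorFamily fun i => σ i (x i))]
    have : O p = ∑ x, (g x p : ℂ) • (Matrix.of fun a b => (o x a b : ℂ)) := by
      ext a b
      simp [hO, Matrix.sum_apply]
    rw [this, Matrix.mul_sum, Matrix.sum_mul]
    refine Finset.sum_congr rfl fun x _ => ?_
    rw [hfac, Matrix.mul_smul, Matrix.smul_mul]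
  rw [distFromUniform, traceDist, cqState_sub, hdist]
  refine mul_le_mul_of_nonneg_left ?_ (by norm_num)
  have hwnn : ∀ j, 0 ≤ w j := fun j => Finset.prod_nonneg fun i _ => (R i).w_nonneg _
  refine (traceNorm_cqState_le hV (fun p => ?_) hwnn fun j hj => ?_).trans
    (Real.sqrt_le_sqrt ?_)
  · ext a b
    rw [Matrix.conjTranspose_apply, hOapp, hOapp, Complex.star_def, Complex.conj_ofReal]
    simp only [ho, (R _).o_symm _ (a _) (b _)]
  · obtain ⟨i, _, hi⟩ := Finset.prod_eq_zero_iff.1 hj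
    exact Finset.prod_eq_zero (Finset.mem_univ i) ((R i).D_eq_zero _ hi)
  set K : (Fin n → Bool) → (Fin n → Bool) → ℝ := fun x y =>
    ∑ a, ∑ b, w a * w b * (o x a b * o y a b) with hK
  have hKprod : ∀ x y, K x y =
      ∏ i, ∑ a, ∑ b, (R i).w a * (R i).w b * ((R i).o (x i) a b * (R i).o (y i) a b) := by
    intro x y
    rw [prod_sum_sum]
    simp only [hK, hw, ho, Finset.prod_mul_distrib]
  -- Needed for x ≠ y, where only an upper bound 0 on the hash covariance is known.
  have hKnn : ∀ x y, 0 ≤ K x y := fun x y => by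
    rw [hKprod]; exact Finset.prod_nonneg fun i _ => (R i).cross_nonneg _ _
  have hDw : ∑ j, (D j / w j) ^ 2 = ∏ i, ∑ j, ((R i).D j / (R i).w j) ^ 2 := by
    simp only [Finset.prod_univ_sum, Fintype.piFinset_univ, hD, hw, ← Finset.prod_div_distrib,
      Finset.prod_pow]
  have hDwnn : 0 ≤ ∑ j, (D j / w j) ^ 2 := Finset.sum_nonneg fun j _ => sq_nonneg _
  have hdiag : ∀ x, (∑ j, (D j / w j) ^ 2) * K x x ≤ (∏ i, T i) ^ 2 := by
    intro x
    rw [hDw, hKprod, ← Finset.prod_mul_distrib, ← Finset.prod_pow]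
    exact Finset.prod_le_prod (fun i _ => mul_nonneg (Finset.sum_nonneg fun j _ => sq_nonneg _)
      ((R i).cross_nonneg _ _)) fun i _ => (R i).bound _
  have hquad : ∀ p, ∑ a, ∑ b, w a * w b * ‖O p a b‖ ^ 2 = ∑ x, ∑ y, g x p * g y p * K x y := by
    intro p
    have h1 : ∀ a b, w a * w b * ‖O p a b‖ ^ 2
        = ∑ x, ∑ y, g x p * g y p * (w a * w b * (o x a b * o y a b)) := by
      intro a b
      rw [hOapp, Complex.norm_real, Real.norm_eq_abs, sq_abs, sq,
        Finset.sum_mul_sum, Finset.mul_sum]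
      refine Finset.sum_congr rfl fun x _ => ?_
      rw [Finset.mul_sum]
      exact Finset.sum_congr rfl fun y _ => by ring
    simp_rw [h1, hK, Finset.mul_sum]
    calc _ = ∑ a, ∑ x, ∑ b, ∑ y, g x p * g y p * (w a * w b * (o x a b * o y a b)) :=
          Finset.sum_congr rfl fun a _ => Finset.sum_comm
      _ = ∑ x, ∑ a, ∑ b, ∑ y, g x p * g y p * (w a * w b * (o x a b * o y a b)) :=
          Finset.sum_comm
      _ = ∑ x, ∑ a, ∑ y, ∑ b, g x p * g y p * (w a * w b * (o x a b * o y a b)) :=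
          Finset.sum_congr rfl fun x _ => Finset.sum_congr rfl fun a _ => Finset.sum_comm
      _ = _ := Finset.sum_congr rfl fun x _ => Finset.sum_comm
  have hsum : 1 / (Fintype.card ((Fin ℓ → Bool) × υ) : ℝ) *
      ∑ p, ∑ a, ∑ b, w a * w b * ‖O p a b‖ ^ 2 ≤
        ((2 : ℝ) ^ ℓ - 1) / (2 ^ n) ^ 2 * ∑ x, K x x := by
    simp_rw [hquad]
    calc _ = ∑ x, ∑ y, (1 / (Fintype.card ((Fin ℓ → Bool) × υ) : ℝ) *
          ∑ p, g x p * g y p) * K x y := by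
          rw [Finset.sum_comm, Finset.mul_sum]
          refine Finset.sum_congr rfl fun x _ => ?_
          rw [Finset.sum_comm, Finset.mul_sum]
          refine Finset.sum_congr rfl fun y _ => ?_
          rw [← Finset.sum_mul]; ring
      _ ≤ ∑ x, ∑ y, (if x = y then ((2 : ℝ) ^ ℓ - 1) / (2 ^ n) ^ 2 else 0) * K x y :=
          Finset.sum_le_sum fun x _ => Finset.sum_le_sum fun y _ =>
            mul_le_mul_of_nonneg_right (sum_hash_mul_hash hExt x y) (hKnn x y)
      _ = _ := by simp [Finset.mul_sum]
  have hℓ : (0 : ℝ) ≤ (2 : ℝ) ^ ℓ - 1 := sub_nonneg.2 (one_le_pow₀ (by norm_num))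
  calc _ ≤ (∑ j, (D j / w j) ^ 2) * (((2 : ℝ) ^ ℓ - 1) / (2 ^ n) ^ 2 * ∑ x, K x x) :=
        mul_le_mul_of_nonneg_left hsum hDwnn
    _ = ((2 : ℝ) ^ ℓ - 1) / (2 ^ n) ^ 2 * ∑ x, (∑ j, (D j / w j) ^ 2) * K x x := by
        rw [← Finset.mul_sum]; ring
    _ ≤ ((2 : ℝ) ^ ℓ - 1) / (2 ^ n) ^ 2 * ∑ _x : Fin n → Bool, (∏ i, T i) ^ 2 :=
        mul_le_mul_of_nonneg_left (Finset.sum_le_sum fun x _ => hdiag x) (by positivity)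
    _ = _ := by
        simp only [Finset.sum_const, Finset.card_univ, Fintype.card_pi, Fintype.card_bool,
          Finset.prod_const, Fintype.card_fin, nsmul_eq_mul]
        push_cast
        field_simp

/-! ### Character sums -/

theorem sgn_mul_self (b : Bool) : sgn b * sgn b = 1 := by cases b <;> simp [sgn]

theorem conj_sgn (b : Bool) : (starRingEnd ℂ) (sgn b) = sgn b := by cases b <;> simp [sgn]

theorem sgn_update_not {d : ℕ} (c : Fin d → Bool) (m t : Fin d) :
    sgn (Function.update c m (!c m) t) = (if t = m then -1 else 1) * sgn (c t) := by
  by_cases h : t = m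
  · subst h; cases c t <;> simp [sgn]
  · simp [h]

/-- The coordinates `a b p q` can be grouped into equal pairs. -/
def Paired {d : ℕ} (a b p q : Fin d) : Prop := (a = b ∧ p = q) ∨ (a = p ∧ b = q) ∨ (a = q ∧ b = p)

instance {d : ℕ} (a b p q : Fin d) : Decidable (Paired a b p q) := by
  unfold Paired; infer_instance

/-- If some index occurs an odd number of times, flipping that bit of c is an involution that
reverses the sign of every summand. -/
theorem sum_sgn_four {d : ℕ} (a b p q : Fin d) :
    ∑ c : Fin d → Bool, sgn (c a) * sgn (c b) * (sgn (c p) * sgn (c q)) =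
      if Paired a b p q then 2 ^ d else 0 := by
  split_ifs with h
  · have : ∀ c : Fin d → Bool, sgn (c a) * sgn (c b) * (sgn (c p) * sgn (c q)) = 1 := by
      intro c
      rcases h with ⟨rfl, rfl⟩ | ⟨rfl, rfl⟩ | ⟨rfl, rfl⟩
      · rw [sgn_mul_self, sgn_mul_self, mul_one]
      · rw [mul_mul_mul_comm, sgn_mul_self, sgn_mul_self, mul_one]
      · rw [mul_comm (sgn (c b)), mul_mul_mul_comm, sgn_mul_self, sgn_mul_self, mul_one]
    simp [this]
  -- Here m is an index of odd multiplicity among a, b, p, q.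
  · obtain ⟨m, hm⟩ : ∃ m : Fin d, (if a = m then (-1 : ℂ) else 1) * (if b = m then -1 else 1) *
        ((if p = m then -1 else 1) * (if q = m then -1 else 1)) = -1 := by
      unfold Paired at h
      by_cases h1 : a = b
      · refine ⟨p, ?_⟩
        have : q ≠ p := fun e => h (Or.inl ⟨h1, e.symm⟩)
        subst h1
        by_cases h2 : a = p <;> simp [h2, this]
      · by_cases h2 : a = p
        · refine ⟨b, ?_⟩
          have : q ≠ b := fun e => h (Or.inr (Or.inl ⟨h2, e.symm⟩))
          subst h2
          simp [h1, this]
        · by_cases h3 : a = q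
          · refine ⟨b, ?_⟩
            have : p ≠ b := fun e => h (Or.inr (Or.inr ⟨h3, e.symm⟩))
            subst h3
            simp [h1, this]
          · exact ⟨a, by simp [Ne.symm h1, Ne.symm h2, Ne.symm h3]⟩
    have hinv : Function.Involutive fun c : Fin d → Bool => Function.update c m (!c m) := by
      intro c; simp
    set e := Function.Involutive.toPerm _ hinv with he
    have key := Equiv.sum_comp e
      (fun c : Fin d → Bool => sgn (c a) * sgn (c b) * (sgn (c p) * sgn (c q)))
    have h2 : ∀ c : Fin d → Bool, (fun c : Fin d → Bool => sgn (c a) * sgn (c b) *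
        (sgn (c p) * sgn (c q))) (e c)
        = -(sgn (c a) * sgn (c b) * (sgn (c p) * sgn (c q))) := by
      intro c
      simp only [he, Function.Involutive.coe_toPerm, sgn_update_not]
      linear_combination (sgn (c a) * sgn (c b) * (sgn (c p) * sgn (c q))) * hm
    simp_rw [h2, Finset.sum_neg_distrib] at key
    exact self_eq_neg.1 key.symm

/-! ### The symmetrised state -/

theorem symmetrise_apply {d : ℕ} (ρ : Matrix (Fin d × Fin d) (Fin d × Fin d) ℂ)
    (p q : Fin d × Fin d) :
    symmetrise ρ p q = if Paired p.1 p.2 q.1 q.2 then permAverage ρ p q else 0 := by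
  have h1 : ∀ c : Fin d → Bool, (phaseFlip c * permAverage ρ * (phaseFlip c).conjTranspose) p q
      = permAverage ρ p q * (sgn (c p.1) * sgn (c p.2) * (sgn (c q.1) * sgn (c q.2))) := by
    intro c
    have : phaseFlip c = Matrix.diagonal fun q : Fin d × Fin d => sgn (c q.1) * sgn (c q.2) := by
      rw [phaseFlip, Matrix.diagonal_kronecker_diagonal]
    rw [this, Matrix.diagonal_conjTranspose, Matrix.mul_diagonal, Matrix.diagonal_mul]
    simp only [Pi.star_apply, Complex.star_def, map_mul, conj_sgn]
    ring
  rw [symmetrise, flipAverage, Matrix.smul_apply, Matrix.sum_apply]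
  simp_rw [h1]
  rw [← Finset.mul_sum, sum_sgn_four]
  split_ifs
  · rw [smul_eq_mul]; field_simp
  · simp

theorem permAverage_perm {d : ℕ} (ρ : Matrix (Fin d × Fin d) (Fin d × Fin d) ℂ)
    (τ : Equiv.Perm (Fin d)) (p q : Fin d × Fin d) :
    permAverage ρ (Prod.map τ τ p) (Prod.map τ τ q) = permAverage ρ p q := by
  rw [permAverage, Matrix.smul_apply, Matrix.smul_apply, Matrix.sum_apply, Matrix.sum_apply]
  congr 1
  exact Equiv.sum_comp (Equiv.mulRight τ)
    fun π : Equiv.Perm (Fin d) => ρ.submatrix (Prod.map π π) (Prod.map π π) p q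

theorem symmetrise_perm {d : ℕ} (ρ : Matrix (Fin d × Fin d) (Fin d × Fin d) ℂ)
    (τ : Equiv.Perm (Fin d)) (a b p q : Fin d) :
    symmetrise ρ (τ a, τ b) (τ p, τ q) = symmetrise ρ (a, b) (p, q) := by
  rw [symmetrise_apply, symmetrise_apply]
  have h1 := permAverage_perm ρ τ (a, b) (p, q)
  simp only [Prod.map_apply] at h1
  simp only [Paired, h1, τ.injective.eq_iff]

/-- The entries of a state with the symmetries of `symmetrise ρ`, relative to the two time
indices `k` and `m`. -/
structure SymValues {d : ℕ} (S : Matrix (Fin d × Fin d) (Fin d × Fin d) ℂ) (k m : Fin d)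
    (A B p q : ℝ) : Prop where
  ne : k ≠ m
  zero : ∀ a b t t', ¬ Paired a b t t' → S (a, b) (t, t') = 0
  kk_kk : S (k, k) (k, k) = A
  mm_mm : S (m, m) (m, m) = A
  kk_mm : S (k, k) (m, m) = B
  mm_kk : S (m, m) (k, k) = B
  km_mk : S (k, m) (m, k) = q
  mk_km : S (m, k) (k, m) = q
  diag_k : ∀ t, t ≠ k → S (t, k) (t, k) = p
  diag_m : ∀ t, t ≠ m → S (t, m) (t, m) = p

/-- Transpositions identify the entries. The off-diagonal ones are real since exchanging k and m has
the same effect on them as Hermitian conjugation; Hermiticity is read off from the purification. -/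
theorem exists_symValues {d : ℕ} {ε : Type*} [Fintype ε]
    {ρ : Matrix (Fin d × Fin d) (Fin d × Fin d) ℂ} {Ψ : (Fin d × Fin d) × ε → ℂ}
    (hΨ : IsPurification (symmetrise ρ) Ψ) {k m : Fin d} (hkm : k ≠ m) :
    ∃ A B p q : ℝ, SymValues (symmetrise ρ) k m A B p q := by
  have hherm : ∀ x y, (starRingEnd ℂ) (symmetrise ρ x y) = symmetrise ρ y x := by
    intro x y
    rw [← hΨ]
    simp [ptraceRight, ketBra, Matrix.vecMulVec_apply, map_sum, mul_comm]
  have hre : ∀ x y, symmetrise ρ x y = symmetrise ρ y x →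
      ((symmetrise ρ x y).re : ℂ) = symmetrise ρ x y := by
    intro x y h
    rw [← Complex.conj_eq_iff_re, hherm, h]
  have hswap := fun a b p q : Fin d => symmetrise_perm ρ (Equiv.swap k m) a b p q
  have hkk_mm : symmetrise ρ (m, m) (k, k) = symmetrise ρ (k, k) (m, m) := by
    simpa using hswap k k m m
  have hkm_mk : symmetrise ρ (m, k) (k, m) = symmetrise ρ (k, m) (m, k) := by
    simpa using hswap k m m k
  have hmk : symmetrise ρ (m, k) (m, k) = symmetrise ρ (k, m) (k, m) := by
    simpa using hswap k m k m
  refine ⟨(symmetrise ρ (k, k) (k, k)).re, (symmetrise ρ (k, k) (m, m)).re,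
    (symmetrise ρ (k, m) (k, m)).re, (symmetrise ρ (k, m) (m, k)).re, hkm, ?_, (hre _ _ rfl).symm,
    ?_, ?_, ?_, ?_, ?_, ?_, ?_⟩
  · intro a b t t' h
    rw [symmetrise_apply, if_neg h]
  · rw [hre _ _ rfl]; simpa using hswap k k k k
  · rw [hre _ _ hkk_mm.symm]
  · rw [hre _ _ hkk_mm.symm, hkk_mm]
  · rw [hre _ _ hkm_mk.symm]
  · rw [hre _ _ hkm_mk.symm, hkm_mk]
  · intro t ht
    rw [hre _ _ rfl, ← hmk]
    have := symmetrise_perm ρ (Equiv.swap t m) t k t k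
    rw [Equiv.swap_apply_left, Equiv.swap_apply_of_ne_of_ne ht.symm hkm] at this
    exact this.symm
  · intro t ht
    rw [hre _ _ rfl]
    have := symmetrise_perm ρ (Equiv.swap t k) t m t m
    rw [Equiv.swap_apply_left, Equiv.swap_apply_of_ne_of_ne ht.symm hkm.symm] at this
    exact this.symm

/-! ### The noise constraint -/

theorem bobM_apply {d : ℕ} (r k : Fin d) (s : Bool) (i j : Fin d) :
    bobM r k s i j = 1 / 4 * (((if i = k then 1 else 0) + sgn s * if i = k + r then 1 else 0) *
      ((if j = k then 1 else 0) + sgn s * if j = k + r then 1 else 0)) := by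
  have h2 : ((√2 : ℝ) : ℂ) * ((√2 : ℝ) : ℂ) = 2 := by
    rw [← Complex.ofReal_mul, Real.mul_self_sqrt (by norm_num)]; norm_num
  have h0 : ((√2 : ℝ) : ℂ) ≠ 0 := by
    intro h; rw [h] at h2; norm_num at h2
  simp only [bobM, ketBra, bobPsi, Matrix.smul_apply, Matrix.vecMulVec_apply, Pi.smul_apply,
    Pi.add_apply, Pi.single_apply, Pi.star_apply, smul_eq_mul, Complex.star_def, map_mul, map_add,
    conj_sgn, map_div₀, map_one, Complex.conj_ofReal, apply_ite (starRingEnd ℂ), map_zero]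
  generalize ((if i = k then (1 : ℂ) else 0) + sgn s * if i = k + r then 1 else 0) = x
  generalize ((if j = k then (1 : ℂ) else 0) + sgn s * if j = k + r then 1 else 0) = y
  field_simp
  linear_combination (-2 * x * y) * h2

theorem aliceQ_apply {d : ℕ} (hd : 0 < d) (a : Fin d → Bool) (i j : Fin d) :
    aliceQ a i j = 1 / 2 ^ d * (sgn (a i) * sgn (a j)) := by
  have h2 : ((√d : ℝ) : ℂ) * ((√d : ℝ) : ℂ) = d := by
    rw [← Complex.ofReal_mul, Real.mul_self_sqrt (by positivity)]; norm_num
  have hd0 : (d : ℂ) ≠ 0 := by exact_mod_cast hd.ne'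
  have h0 : ((√d : ℝ) : ℂ) ≠ 0 := by
    intro h; rw [h] at h2; exact hd0 (by rw [← h2]; ring)
  simp only [aliceQ, ketBra, mu, Matrix.smul_apply, Matrix.vecMulVec_apply, Pi.star_apply,
    smul_eq_mul, Complex.star_def, map_mul, conj_sgn, map_div₀, map_one, Complex.conj_ofReal]
  field_simp
  linear_combination (-(sgn (a i) * sgn (a j))) * h2

theorem sum_eq_add_add_sum_ite {d : ℕ} {M : Type*} [AddCommMonoid M] {k m : Fin d} (h : k ≠ m)
    (f : Fin d → M) : ∑ t, f t = f k + f m + ∑ t, if t = k ∨ t = m then 0 else f t := by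
  have : ∀ t, f t = ((if t = k then f t else 0) + (if t = m then f t else 0))
      + if t = k ∨ t = m then 0 else f t := by
    intro t
    by_cases h1 : t = k
    · subst h1; simp [h]
    · by_cases h2 : t = m
      · subst h2; simp [h1]
      · simp [h1, h2]
  conv_lhs => enter [2, t]; rw [this]
  simp [Finset.sum_add_distrib]

theorem SymValues.sum_diag_k {d : ℕ} {S : Matrix (Fin d × Fin d) (Fin d × Fin d) ℂ} {k m : Fin d}
    {A B p q : ℝ} (h : SymValues S k m A B p q) :
    ∑ t, S (t, k) (t, k) = A + (d - 1) * p := by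
  have : ∀ t, S (t, k) (t, k) = p + if t = k then (A : ℂ) - p else 0 := by
    intro t
    split_ifs with ht
    · subst ht; rw [h.kk_kk]; ring
    · rw [h.diag_k t ht]; ring
  simp_rw [this, Finset.sum_add_distrib]
  simp
  ring

theorem SymValues.sum_diag_m {d : ℕ} {S : Matrix (Fin d × Fin d) (Fin d × Fin d) ℂ} {k m : Fin d}
    {A B p q : ℝ} (h : SymValues S k m A B p q) :
    ∑ t, S (t, m) (t, m) = A + (d - 1) * p := by
  have : ∀ t, S (t, m) (t, m) = p + if t = m then (A : ℂ) - p else 0 := by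
    intro t
    split_ifs with ht
    · subst ht; rw [h.mm_mm]; ring
    · rw [h.diag_m t ht]; ring
  simp_rw [this, Finset.sum_add_distrib]
  simp
  ring

theorem SymValues.trace_outcome {d : ℕ} (hd : 0 < d)
    {S : Matrix (Fin d × Fin d) (Fin d × Fin d) ℂ}
    {k m r : Fin d} {A B p q : ℝ} (h : SymValues S k m A B p q) (hm : k + r = m) (s : Bool) :
    ((aliceQ (fun _ => false) ⊗ₖ bobM r k s) * S).trace =
      1 / 2 ^ d * (1 / 2 * ((A + (d - 1) * p) + sgn s * (B + q))) := by
  have e1 : ∀ t t', S (t', k) (t, k) = if t' = t then S (t, k) (t, k) else 0 := by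
    intro t t'
    split_ifs with ht
    · rw [ht]
    · exact h.zero _ _ _ _ (by
        rintro (⟨h1, h2⟩ | ⟨h1, h2⟩ | ⟨h1, h2⟩)
        · exact ht (h1.trans h2.symm)
        · exact ht h1
        · exact ht (h1.trans h2))
  have e2 : ∀ t t', S (t', m) (t, m) =
      if t' = t then S (t, m) (t, m) else 0 := by
    intro t t'
    split_ifs with ht
    · rw [ht]
    · exact h.zero _ _ _ _ (by
        rintro (⟨h1, h2⟩ | ⟨h1, h2⟩ | ⟨h1, h2⟩)
        · exact ht (h1.trans h2.symm)
        · exact ht h1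
        · exact ht (h1.trans h2))
  have e3 : ∀ t t', S (t', m) (t, k) =
      (if t' = m then (if t = k then (B : ℂ) else 0) else 0)
        + (if t' = k then (if t = m then (q : ℂ) else 0) else 0) := by
    intro t t'
    by_cases h1 : t' = m ∧ t = k
    · obtain ⟨rfl, rfl⟩ := h1; rw [h.mm_kk]; simp [h.ne.symm]
    · by_cases h2 : t' = k ∧ t = m
      · obtain ⟨rfl, rfl⟩ := h2; rw [h.km_mk]; simp [h.ne]
      · rw [h.zero]
        · rw [not_and] at h1 h2
          split_ifs <;> simp_all
        · rintro (⟨h3, h4⟩ | ⟨h3, h4⟩ | ⟨h3, h4⟩)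
          · exact h1 ⟨h3, h4⟩
          · exact h.ne h4.symm
          · exact h2 ⟨h3, h4.symm⟩
  have e4 : ∀ t t', S (t', k) (t, m) =
      (if t' = k then (if t = m then (B : ℂ) else 0) else 0)
        + (if t' = m then (if t = k then (q : ℂ) else 0) else 0) := by
    intro t t'
    by_cases h1 : t' = k ∧ t = m
    · obtain ⟨rfl, rfl⟩ := h1; rw [h.kk_mm]; simp [h.ne]
    · by_cases h2 : t' = m ∧ t = k
      · obtain ⟨rfl, rfl⟩ := h2; rw [h.mk_km]; simp [h.ne.symm]
      · rw [h.zero]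
        · rw [not_and] at h1 h2
          split_ifs <;> simp_all
        · rintro (⟨h3, h4⟩ | ⟨h3, h4⟩ | ⟨h3, h4⟩)
          · exact h1 ⟨h3, h4⟩
          · exact h.ne h4
          · exact h2 ⟨h3, h4.symm⟩
  have step : ((aliceQ (fun _ => false) ⊗ₖ bobM r k s) * S).trace =
      1 / 2 ^ d * (1 / 4 * (∑ t, ∑ t', (S (t', k) (t, k) + sgn s * S (t', m) (t, k)
        + sgn s * S (t', k) (t, m) + S (t', m) (t, m)))) := by
    simp only [Matrix.trace, Matrix.diag_apply, Matrix.mul_apply, Fintype.sum_prod_type,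
      Matrix.kroneckerMap_apply, aliceQ_apply hd, bobM_apply, hm]
    rw [Finset.mul_sum, Finset.mul_sum]
    refine Finset.sum_congr rfl fun t _ => ?_
    rw [Finset.sum_comm, Finset.mul_sum, Finset.mul_sum]
    refine Finset.sum_congr rfl fun t' _ => ?_
    simp only [mul_add, add_mul, mul_ite, ite_mul, mul_one, mul_zero, zero_mul, one_mul,
      Finset.sum_add_distrib, Finset.sum_ite_eq', Finset.mem_univ, if_true,
      show sgn false = 1 from rfl]
    linear_combination (1 / 2 ^ d * (1 / 4) * S (t', m) (t, m)) * sgn_mul_self s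
  rw [step]
  have s1 : ∑ t, ∑ t', S (t', k) (t, k) = A + (d - 1) * p := by
    rw [← h.sum_diag_k]
    exact Finset.sum_congr rfl fun t _ => by
      rw [Finset.sum_congr rfl fun t' _ => e1 t t', Finset.sum_ite_eq', if_pos (Finset.mem_univ _)]
  have s2 : ∑ t, ∑ t', S (t', m) (t, m) = A + (d - 1) * p := by
    rw [← h.sum_diag_m]
    exact Finset.sum_congr rfl fun t _ => by
      rw [Finset.sum_congr rfl fun t' _ => e2 t t', Finset.sum_ite_eq', if_pos (Finset.mem_univ _)]
  have s3 : ∑ t, ∑ t', S (t', m) (t, k) = B + q := by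
    simp_rw [e3]; simp [Finset.sum_add_distrib]
  have s4 : ∑ t, ∑ t', S (t', k) (t, m) = B + q := by
    simp_rw [e4]; simp [Finset.sum_add_distrib]
  simp only [Finset.sum_add_distrib, ← Finset.mul_sum, s1, s2, s3, s4]
  ring

/-- Alice's outcome a = 0 suffices: the sum of the probabilities for s = 0 and s = 1 fixes A +
(d-1)p, and their difference fixes B + q. -/
theorem SymValues.of_noise {d : ℕ} (hd : 0 < d) {S : Matrix (Fin d × Fin d) (Fin d × Fin d) ℂ}
    {k r : Fin d} {A B p q b : ℝ} (h : SymValues S k (k + r) A B p q) (hr : (r : ℕ) ≠ 0)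
    (hS : NoiseConstraint S b) : d * (A + (d - 1) * p) = 1 ∧ d * (B + q) = 1 - 2 * b := by
  have h0 := hS (fun _ => false) k false r hr
  have h1 := hS (fun _ => false) k true r hr
  rw [h.trace_outcome hd rfl] at h0 h1
  simp only [sgn] at h0 h1
  norm_num at h0 h1
  have hd0 : (d : ℝ) ≠ 0 := by positivity
  have h2 : ((2 : ℝ) ^ d) ≠ 0 := by positivity
  have hdc : (d : ℂ) ≠ 0 := by exact_mod_cast hd.ne'
  field_simp at h0 h1
  have h0' : d * (A + (d - 1) * p + (B + q)) = 2 * (1 - b) :=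
    Complex.ofReal_injective (by push_cast; linear_combination h0)
  have h1' : d * (A + (d - 1) * p - (B + q)) = 2 * b :=
    Complex.ofReal_injective (by push_cast; linear_combination h1)
  constructor <;> linarith

/-! ### Eve's states -/

theorem sum_aliceQ {d : ℕ} (hd : 0 < d) {k m : Fin d} (hkm : k ≠ m) (s : Bool) (t t' : Fin d) :
    ∑ a : Fin d → Bool, (if xor (a k) (a m) = s then aliceQ a t t' else 0) =
      1 / 2 * ((if t = t' then 1 else 0) + sgn s *
        ((if t = k then 1 else 0) * (if t' = m then 1 else 0)
          + (if t = m then 1 else 0) * (if t' = k then 1 else 0))) := by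
  -- The indicator of the bit is (1 + (-1)^s (-1)^{a_k + a_m})/2. The redundant square of the sign
  -- of a_k puts both terms into the form of `sum_sgn_four`.
  have h1 : ∀ a : Fin d → Bool, (if xor (a k) (a m) = s then aliceQ a t t' else 0)
      = 1 / 2 ^ d * (1 / 2) * (sgn (a t) * sgn (a t') * (sgn (a k) * sgn (a k))
        + sgn s * (sgn (a t) * sgn (a t') * (sgn (a k) * sgn (a m)))) := by
    intro a
    rw [aliceQ_apply hd]
    generalize sgn (a t) = x
    generalize sgn (a t') = y
    cases a k <;> cases a m <;> cases s <;> simp [sgn] <;> ring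
  simp_rw [h1]
  rw [← Finset.mul_sum, Finset.sum_add_distrib, ← Finset.mul_sum, sum_sgn_four, sum_sgn_four]
  have e1 : Paired t t' k k ↔ t = t' := by
    unfold Paired; constructor
    · rintro (⟨h, -⟩ | ⟨h, h'⟩ | ⟨h, h'⟩)
      · exact h
      · exact h.trans h'.symm
      · exact h.trans h'.symm
    · exact fun h => Or.inl ⟨h, rfl⟩
  have e2 : Paired t t' k m ↔ (t = k ∧ t' = m) ∨ (t = m ∧ t' = k) := by
    unfold Paired; constructor
    · rintro (⟨-, h⟩ | h | h)
      · exact absurd h hkm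
      · exact Or.inl h
      · exact Or.inr h
    · exact Or.inr
  simp only [e1, e2]
  by_cases h2 : t = k
  · by_cases h3 : t' = m
    · subst h2 h3; simp [hkm]; field_simp
    · subst h2; simp [hkm, h3]; split_ifs <;> field_simp
  · by_cases h3 : t = m
    · subst h3; simp [h2]; split_ifs <;> field_simp <;> simp
    · simp [h2, h3]; split_ifs <;> field_simp

theorem sum_bobM {d : ℕ} (r k : Fin d) (i j : Fin d) :
    ∑ s, bobM r k s i j = 1 / 2 * ((if i = k then 1 else 0) * (if j = k then 1 else 0)
      + (if i = k + r then 1 else 0) * (if j = k + r then 1 else 0)) := by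
  rw [Fintype.sum_bool, bobM_apply, bobM_apply]
  simp only [sgn]
  generalize (if i = k then (1 : ℂ) else 0) = a
  generalize (if j = k then (1 : ℂ) else 0) = b
  generalize (if i = k + r then (1 : ℂ) else 0) = a'
  generalize (if j = k + r then (1 : ℂ) else 0) = b'
  simp
  ring

theorem eveOutcome_apply {d : ℕ} {ε : Type*} [Fintype ε] [DecidableEq ε]
    (Ψ : (Fin d × Fin d) × ε → ℂ) (a : Fin d → Bool) (r k : Fin d) (s : Bool) (e e' : ε) :
    eveOutcome Ψ a r k s e e' = ∑ p : Fin d × Fin d, ∑ q : Fin d × Fin d,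
      Ψ (p, e) * (starRingEnd ℂ) (Ψ (q, e')) * (aliceQ a q.1 p.1 * bobM r k s q.2 p.2) := by
  simp only [eveOutcome, ptraceLeft, Matrix.of_apply, Matrix.mul_apply]
  refine Finset.sum_congr rfl fun p _ => ?_
  rw [Fintype.sum_prod_type]
  refine Finset.sum_congr rfl fun q _ => ?_
  simp [ketBra, Matrix.vecMulVec_apply, Matrix.kroneckerMap_apply, Matrix.one_apply]

/-- Summed over his bit, Bob's POVM leaves the incoherent components k and m. Summed over a, Alice's
POVM leaves the identity plus a coherence between k and m whose sign is her bit. -/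
theorem eveBitOutcome_apply {d : ℕ} (hd : 0 < d) {ε : Type*} [Fintype ε] [DecidableEq ε]
    (Ψ : (Fin d × Fin d) × ε → ℂ) {r k m : Fin d} (hm : k + r = m) (hkm : k ≠ m) (s : Bool)
    (e e' : ε) :
    eveBitOutcome Ψ r k s e e' = 1 / 4 * (∑ t, (Ψ ((t, k), e) * (starRingEnd ℂ) (Ψ ((t, k), e'))
        + Ψ ((t, m), e) * (starRingEnd ℂ) (Ψ ((t, m), e')))
      + sgn s * (Ψ ((k, k), e) * (starRingEnd ℂ) (Ψ ((m, k), e'))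
        + Ψ ((m, k), e) * (starRingEnd ℂ) (Ψ ((k, k), e'))
        + Ψ ((k, m), e) * (starRingEnd ℂ) (Ψ ((m, m), e'))
        + Ψ ((m, m), e) * (starRingEnd ℂ) (Ψ ((k, m), e')))) := by
  have h1 : eveBitOutcome Ψ r k s e e' = ∑ p : Fin d × Fin d, ∑ q : Fin d × Fin d,
      Ψ (p, e) * (starRingEnd ℂ) (Ψ (q, e')) *
        ((∑ a : Fin d → Bool, (if xor (a k) (a m) = s then aliceQ a q.1 p.1 else 0)) *
          ∑ s', bobM r k s' q.2 p.2) := by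
    rw [eveBitOutcome, Matrix.sum_apply]
    simp_rw [Matrix.sum_apply, hm]
    have h2 : ∀ (a : Fin d → Bool) (s' : Bool),
        (if xor (a k) (a m) = s then eveOutcome Ψ a r k s' else 0) e e' =
        ∑ p : Fin d × Fin d, ∑ q : Fin d × Fin d, Ψ (p, e) * (starRingEnd ℂ) (Ψ (q, e')) *
          ((if xor (a k) (a m) = s then aliceQ a q.1 p.1 else 0) * bobM r k s' q.2 p.2) := by
      intro a s'
      split_ifs
      · rw [eveOutcome_apply]
      · simp
    simp_rw [h2, Finset.sum_mul_sum, Finset.mul_sum]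
    calc _ = ∑ a, ∑ p, ∑ s', ∑ q, _ := Finset.sum_congr rfl fun a _ => Finset.sum_comm
      _ = ∑ p, ∑ a, ∑ s', ∑ q, _ := Finset.sum_comm
      _ = ∑ p, ∑ a, ∑ q, ∑ s', _ :=
        Finset.sum_congr rfl fun p _ => Finset.sum_congr rfl fun a _ => Finset.sum_comm
      _ = _ := Finset.sum_congr rfl fun p _ => Finset.sum_comm
  rw [h1]
  simp_rw [sum_aliceQ hd hkm, sum_bobM, hm, Fintype.sum_prod_type]
  have h3 : ∀ f g : Fin d → Fin d → ℂ,
      ∑ t', ∑ i', ∑ t, ∑ i, f t' i' * g t i * (1 / 2 * ((if t = t' then 1 else 0) + sgn s *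
        ((if t = k then 1 else 0) * (if t' = m then 1 else 0)
          + (if t = m then 1 else 0) * (if t' = k then 1 else 0))) *
        (1 / 2 * ((if i = k then 1 else 0) * (if i' = k then 1 else 0)
          + (if i = m then 1 else 0) * (if i' = m then 1 else 0))))
      = 1 / 4 * (∑ t, (f t k * g t k + f t m * g t m) + sgn s * (f k k * g m k + f m k * g k k
        + f k m * g m m + f m m * g k m)) := by
    intro f g
    have h4 : ∀ t' i' t, ∑ i, f t' i' * g t i * (1 / 2 * ((if t = t' then 1 else 0) + sgn s *
        ((if t = k then 1 else 0) * (if t' = m then 1 else 0)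
          + (if t = m then 1 else 0) * (if t' = k then 1 else 0))) *
        (1 / 2 * ((if i = k then 1 else 0) * (if i' = k then 1 else 0)
          + (if i = m then 1 else 0) * (if i' = m then 1 else 0))))
        = 1 / 4 * ((if t = t' then 1 else 0) + sgn s *
        ((if t = k then 1 else 0) * (if t' = m then 1 else 0)
          + (if t = m then 1 else 0) * (if t' = k then 1 else 0))) *
          ((if i' = k then f t' i' * g t k else 0) + if i' = m then f t' i' * g t m else 0) := by
      intro t' i' t
      generalize ((if t = t' then (1 : ℂ) else 0) + sgn s *
        ((if t = k then 1 else 0) * (if t' = m then 1 else 0)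
          + (if t = m then 1 else 0) * (if t' = k then 1 else 0))) = c
      have : ∀ i, f t' i' * g t i * (1 / 2 * c *
          (1 / 2 * ((if i = k then 1 else 0) * (if i' = k then 1 else 0)
            + (if i = m then 1 else 0) * (if i' = m then 1 else 0))))
          = (if i = k then c / 4 * (if i' = k then f t' i' * g t i else 0) else 0)
            + if i = m then c / 4 * (if i' = m then f t' i' * g t i else 0) else 0 := by
        intro i; split_ifs <;> ring
      simp_rw [this]
      rw [Finset.sum_add_distrib, Finset.sum_ite_eq', Finset.sum_ite_eq',
        if_pos (Finset.mem_univ _), if_pos (Finset.mem_univ _)]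
      ring
    simp_rw [h4]
    have h5 : ∀ t' t, ∑ i', 1 / 4 * ((if t = t' then 1 else 0) + sgn s *
        ((if t = k then 1 else 0) * (if t' = m then 1 else 0)
          + (if t = m then 1 else 0) * (if t' = k then 1 else 0))) *
          ((if i' = k then f t' i' * g t k else 0) + if i' = m then f t' i' * g t m else 0)
        = 1 / 4 * ((if t = t' then 1 else 0) + sgn s *
        ((if t = k then 1 else 0) * (if t' = m then 1 else 0)
          + (if t = m then 1 else 0) * (if t' = k then 1 else 0))) *
          (f t' k * g t k + f t' m * g t m) := by
      intro t' t
      rw [← Finset.mul_sum, Finset.sum_add_distrib, Finset.sum_ite_eq', Finset.sum_ite_eq',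
        if_pos (Finset.mem_univ _), if_pos (Finset.mem_univ _)]
    calc _ = ∑ t', ∑ t, (1 / 4 * ((if t = t' then 1 else 0) + sgn s *
        ((if t = k then 1 else 0) * (if t' = m then 1 else 0)
          + (if t = m then 1 else 0) * (if t' = k then 1 else 0))) *
          (f t' k * g t k + f t' m * g t m)) := by
          refine Finset.sum_congr rfl fun t' _ => ?_
          rw [Finset.sum_comm]
          exact Finset.sum_congr rfl fun t _ => h5 t' t
      _ = ∑ t', 1 / 4 * ((f t' k * g t' k + f t' m * g t' m)
          + sgn s * ((if t' = m then f t' k * g k k + f t' m * g k m else 0)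
            + if t' = k then f t' k * g m k + f t' m * g m m else 0)) := by
          refine Finset.sum_congr rfl fun t' _ => ?_
          have : ∀ t, 1 / 4 * ((if t = t' then 1 else 0) + sgn s *
              ((if t = k then 1 else 0) * (if t' = m then 1 else 0)
                + (if t = m then 1 else 0) * (if t' = k then 1 else 0))) *
                (f t' k * g t k + f t' m * g t m)
              = (if t = t' then 1 / 4 * (f t' k * g t k + f t' m * g t m) else 0)
                + ((if t = k then (if t' = m then
                    1 / 4 * sgn s * (f t' k * g t k + f t' m * g t m) else 0) else 0)
                + if t = m then (if t' = k then
                    1 / 4 * sgn s * (f t' k * g t k + f t' m * g t m) else 0) else 0) := by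
            intro t; split_ifs <;> ring
          simp_rw [this]
          rw [Finset.sum_add_distrib, Finset.sum_add_distrib, Finset.sum_ite_eq',
            Finset.sum_ite_eq', Finset.sum_ite_eq', if_pos (Finset.mem_univ _),
            if_pos (Finset.mem_univ _), if_pos (Finset.mem_univ _)]
          split_ifs <;> ring
      _ = _ := by
          rw [← Finset.mul_sum, Finset.sum_add_distrib, ← Finset.mul_sum,
            Finset.sum_add_distrib (f := fun i => if i = m then _ else _), Finset.sum_ite_eq',
            Finset.sum_ite_eq', if_pos (Finset.mem_univ _),
            if_pos (Finset.mem_univ _)]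
          ring
  exact h3 (fun t i => Ψ ((t, i), e)) fun t i => (starRingEnd ℂ) (Ψ ((t, i), e'))

theorem purification_inner {ι ε : Type*} [Fintype ε] {ρ : Matrix ι ι ℂ} {Ψ : ι × ε → ℂ}
    (hΨ : IsPurification ρ Ψ) (p q : ι) :
    ∑ e, Ψ (p, e) * (starRingEnd ℂ) (Ψ (q, e)) = ρ p q := by
  rw [← hΨ]
  simp [ptraceRight, ketBra, Matrix.vecMulVec_apply]

/-- The bit-dependent terms trace to unpaired entries, which vanish. -/
theorem trace_eveBitOutcome {d : ℕ} (hd : 0 < d) {ε : Type*} [Fintype ε] [DecidableEq ε]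
    {S : Matrix (Fin d × Fin d) (Fin d × Fin d) ℂ} {Ψ : (Fin d × Fin d) × ε → ℂ}
    (hΨ : IsPurification S Ψ) {r k m : Fin d} (hm : k + r = m) {A B p q : ℝ}
    (h : SymValues S k m A B p q) (hX : d * (A + (d - 1) * p) = 1) (s : Bool) :
    (eveBitOutcome Ψ r k s).trace = 1 / (2 * d) := by
  have hd0 : (d : ℂ) ≠ 0 := by exact_mod_cast hd.ne'
  have hX' : (d : ℂ) * (A + (d - 1) * p) = 1 := by exact_mod_cast congrArg ((↑) : ℝ → ℂ) hX
  simp only [Matrix.trace, Matrix.diag_apply, eveBitOutcome_apply hd Ψ hm h.ne]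
  rw [← Finset.mul_sum, Finset.sum_add_distrib, ← Finset.mul_sum, Finset.sum_add_distrib,
    Finset.sum_add_distrib, Finset.sum_add_distrib, Finset.sum_comm]
  simp_rw [Finset.sum_add_distrib, purification_inner hΨ]
  have hne := h.ne
  rw [h.sum_diag_k, h.sum_diag_m, h.zero k k m k (by simp [Paired, hne, hne.symm]),
    h.zero m k k k (by simp [Paired, hne.symm]), h.zero k m m m (by simp [Paired, hne]),
    h.zero m m k m (by simp [Paired, hne, hne.symm])]
  field_simp
  linear_combination 4 * hX'

theorem eveState_apply {d : ℕ} (hd : 0 < d) {ε : Type*} [Fintype ε] [DecidableEq ε]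
    {S : Matrix (Fin d × Fin d) (Fin d × Fin d) ℂ} {Ψ : (Fin d × Fin d) × ε → ℂ}
    (hΨ : IsPurification S Ψ) {r k m : Fin d} (hm : k + r = m) {A B p q : ℝ}
    (h : SymValues S k m A B p q) (hX : d * (A + (d - 1) * p) = 1) (s : Bool) (e e' : ε) :
    eveState Ψ r k s e e' = d / 2 *
      (∑ t, (Ψ ((t, k), e) * (starRingEnd ℂ) (Ψ ((t, k), e'))
        + Ψ ((t, m), e) * (starRingEnd ℂ) (Ψ ((t, m), e')))
      + sgn s * (Ψ ((k, k), e) * (starRingEnd ℂ) (Ψ ((m, k), e'))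
        + Ψ ((m, k), e) * (starRingEnd ℂ) (Ψ ((k, k), e'))
        + Ψ ((k, m), e) * (starRingEnd ℂ) (Ψ ((m, m), e'))
        + Ψ ((m, m), e) * (starRingEnd ℂ) (Ψ ((k, m), e')))) := by
  rw [eveState, Matrix.smul_apply, trace_eveBitOutcome hd hΨ hm h hX,
    eveBitOutcome_apply hd Ψ hm h.ne, smul_eq_mul]
  simp only [one_div, inv_inv]
  ring

/-! ### Orthogonal decomposition of Eve's states -/

/-- The real sign `(-1)^b`. -/
def realSgn (b : Bool) : ℝ := if b then -1 else 1

theorem sgn_eq_realSgn (b : Bool) : sgn b = (realSgn b : ℂ) := by cases b <;> simp [sgn, realSgn]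

theorem realSgn_true : realSgn true = -1 := by simp [realSgn]

theorem realSgn_false : realSgn false = 1 := by simp [realSgn]

theorem realSgn_mul_self (b : Bool) : realSgn b * realSgn b = 1 := by
  cases b <;> simp [realSgn]

/-- Labels of the orthogonal vectors spanning Eve's states: `(c, s)` for the combinations
`|kk⟩ ± |mm⟩` and `|km⟩ ± |mk⟩`, and `(t, c)` for `|tk⟩`, `|tm⟩`. -/
abbrev Label (d : ℕ) : Type := (Bool × Bool) ⊕ (Fin d × Bool)

/-- The orthogonal ancilla vectors. -/
def eveVec {d : ℕ} {ε : Type*} (Ψ : (Fin d × Fin d) × ε → ℂ) (k m : Fin d) :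
    Matrix ε (Label d) ℂ :=
  Matrix.of fun e j => match j with
    | Sum.inl (c, s) => (1 / (√2 : ℂ)) *
        (Ψ ((k, if c then m else k), e) + sgn s * Ψ ((m, if c then k else m), e))
    | Sum.inr (t, c) => if t = k ∨ t = m then 0 else Ψ ((t, if c then m else k), e)

/-- The squared norms of the ancilla vectors. -/
def eveNorm {d : ℕ} (k m : Fin d) (A B p q : ℝ) : Label d → ℝ
  | Sum.inl (false, s) => A + realSgn s * B
  | Sum.inl (true, s) => p + realSgn s * q
  | Sum.inr (t, _) => if t = k ∨ t = m then 0 else p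

/-- The coefficients of Eve's state for the bit `s` with respect to the ancilla vectors. -/
def eveCoeff (d : ℕ) (s : Bool) : Label d → Label d → ℝ
  | Sum.inl (c, t), Sum.inl (c', t') =>
      if t = t' then (if c = c' then (d : ℝ) / 2 else d / 2 * (realSgn s * realSgn t)) else 0
  | Sum.inr x, Sum.inr y => if x = y then (d : ℝ) / 2 else 0
  | _, _ => 0

/-- The weights of the ancilla vectors. -/
def eveWeight {d : ℕ} (D : Label d → ℝ) : Label d → ℝ
  | Sum.inl (c, s) => √√(D (Sum.inl (c, s))) ^ 3 /
      √√(D (Sum.inl (false, s)) + D (Sum.inl (true, s)))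
  | Sum.inr x => √(D (Sum.inr x))

theorem sqrt_two_sq_complex : ((√2 : ℝ) : ℂ) ^ 2 = 2 := by
  rw [← Complex.ofReal_pow, Real.sq_sqrt (by norm_num)]; norm_num

theorem inv_sqrt_two_mul_self : 1 / ((√2 : ℝ) : ℂ) * (1 / ((√2 : ℝ) : ℂ)) = 1 / 2 := by
  rw [div_mul_div_comm, ← sq ((√2 : ℝ) : ℂ), sqrt_two_sq_complex, one_mul]

theorem eveCoeff_symm {d : ℕ} (s : Bool) (i j : Label d) : eveCoeff d s i j = eveCoeff d s j i := by
  rcases i with ⟨c, t⟩ | x <;> rcases j with ⟨c', t'⟩ | y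
  · cases c <;> cases t <;> cases c' <;> cases t' <;> simp [eveCoeff]
  · rfl
  · rfl
  · simp only [eveCoeff, eq_comm]

/-- On the span of kk, km, mk, mm the state is a sum of two rank-one operators, and rotating them
into the sectors ± gives v₀ ± v₁ in each, where only the relative sign depends on the bit. Thus V is
independent of the bit. -/
theorem eveState_factor {d : ℕ} (hd : 0 < d) {ε : Type*} [Fintype ε] [DecidableEq ε]
    {S : Matrix (Fin d × Fin d) (Fin d × Fin d) ℂ} {Ψ : (Fin d × Fin d) × ε → ℂ}
    (hΨ : IsPurification S Ψ) {r k m : Fin d} (hm : k + r = m) {A B p q : ℝ}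
    (h : SymValues S k m A B p q) (hX : d * (A + (d - 1) * p) = 1) (s : Bool) :
    eveState Ψ r k s = eveVec Ψ k m * (Matrix.of fun i j => (eveCoeff d s i j : ℂ)) *
      (eveVec Ψ k m).conjTranspose := by
  ext e e'
  rw [eveState_apply hd hΨ hm h hX, sum_eq_add_add_sum_ite h.ne]
  set V := eveVec Ψ k m with hV
  have hrr : ∑ x : Fin d × Bool, ∑ y : Fin d × Bool, V e (Sum.inr y) *
      (eveCoeff d s (Sum.inr y) (Sum.inr x) : ℂ) * (starRingEnd ℂ) (V e' (Sum.inr x))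
      = d / 2 * ∑ t, if t = k ∨ t = m then 0 else
        (Ψ ((t, k), e) * (starRingEnd ℂ) (Ψ ((t, k), e'))
        + Ψ ((t, m), e) * (starRingEnd ℂ) (Ψ ((t, m), e'))) := by
    have h1 : ∀ x : Fin d × Bool, ∑ y : Fin d × Bool, V e (Sum.inr y) *
        (eveCoeff d s (Sum.inr y) (Sum.inr x) : ℂ) * (starRingEnd ℂ) (V e' (Sum.inr x))
        = V e (Sum.inr x) * (d / 2) * (starRingEnd ℂ) (V e' (Sum.inr x)) := by
      intro x
      rw [Finset.sum_eq_single x]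
      · simp [eveCoeff]
      · intro y _ hy; simp [eveCoeff, hy]
      · simp
    simp_rw [h1]
    rw [Fintype.sum_prod_type, Finset.mul_sum]
    refine Finset.sum_congr rfl fun t _ => ?_
    by_cases ht : t = k ∨ t = m
    · simp [hV, eveVec, ht]
    · simp only [Fintype.sum_bool, hV, eveVec, Matrix.of_apply, ht, if_true, if_false,
        Bool.false_eq_true]
      ring
  have hexp : (V * (Matrix.of fun i j => (eveCoeff d s i j : ℂ)) * V.conjTranspose) e e' =
      ∑ x : Bool × Bool, ∑ y : Bool × Bool, V e (Sum.inl y) *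
        (eveCoeff d s (Sum.inl y) (Sum.inl x) : ℂ) * (starRingEnd ℂ) (V e' (Sum.inl x))
      + ∑ x : Fin d × Bool, ∑ y : Fin d × Bool, V e (Sum.inr y) *
        (eveCoeff d s (Sum.inr y) (Sum.inr x) : ℂ) * (starRingEnd ℂ) (V e' (Sum.inr x)) := by
    simp only [Matrix.mul_apply, Fintype.sum_sum_type, Matrix.of_apply, Matrix.conjTranspose_apply,
      Complex.star_def]
    congr 1
    · refine Finset.sum_congr rfl fun x _ => ?_
      simp [eveCoeff, Finset.sum_mul]
    · refine Finset.sum_congr rfl fun x _ => ?_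
      simp [eveCoeff, Finset.sum_mul]
  rw [hexp, hrr]
  simp only [Fintype.sum_prod_type, Fintype.sum_bool, hV, eveVec, Matrix.of_apply, eveCoeff,
    sgn_eq_realSgn s, map_mul, map_add, map_div₀, map_one, Complex.conj_ofReal]
  have h2 := inv_sqrt_two_mul_self
  generalize (1 / ((√2 : ℝ) : ℂ)) = z at *
  generalize (∑ t, if t = k ∨ t = m then 0 else
        (Ψ ((t, k), e) * (starRingEnd ℂ) (Ψ ((t, k), e'))
        + Ψ ((t, m), e) * (starRingEnd ℂ) (Ψ ((t, m), e')))) = R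
  simp only [if_true, if_false, Bool.false_eq_true, reduceCtorEq, realSgn_true,
    realSgn_false, sgn, map_neg, map_one]
  push_cast
  linear_combination (-(d : ℂ) * (Ψ ((k, k), e) * (starRingEnd ℂ) (Ψ ((k, k), e'))
    + Ψ ((k, m), e) * (starRingEnd ℂ) (Ψ ((k, m), e'))
    + Ψ ((m, k), e) * (starRingEnd ℂ) (Ψ ((m, k), e'))
    + Ψ ((m, m), e) * (starRingEnd ℂ) (Ψ ((m, m), e'))
    + realSgn s * (Ψ ((k, k), e) * (starRingEnd ℂ) (Ψ ((m, k), e'))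
      + Ψ ((m, k), e) * (starRingEnd ℂ) (Ψ ((k, k), e'))
      + Ψ ((k, m), e) * (starRingEnd ℂ) (Ψ ((m, m), e'))
      + Ψ ((m, m), e) * (starRingEnd ℂ) (Ψ ((k, m), e'))))) * h2

/-- Inner products of ancilla vectors are entries of S. Vectors of different families only meet in
unpaired entries, and opposite signs within a family cancel by the exchange symmetry of k and m. -/
theorem eveVec_gram {d : ℕ} {ε : Type*} [Fintype ε]
    {S : Matrix (Fin d × Fin d) (Fin d × Fin d) ℂ} {Ψ : (Fin d × Fin d) × ε → ℂ}
    (hΨ : IsPurification S Ψ) {k m : Fin d} {A B p q : ℝ} (h : SymValues S k m A B p q) :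
    (eveVec Ψ k m).conjTranspose * eveVec Ψ k m =
      Matrix.diagonal fun j => (eveNorm k m A B p q j : ℂ) := by
  have hin := purification_inner hΨ
  have hne := h.ne
  have hne' := h.ne.symm
  have hherm : ((eveVec Ψ k m).conjTranspose * eveVec Ψ k m).IsHermitian :=
    Matrix.isHermitian_conjTranspose_mul_self _
  have hlr : ∀ (x : Bool × Bool) (y : Fin d × Bool),
      ((eveVec Ψ k m).conjTranspose * eveVec Ψ k m) (Sum.inl x) (Sum.inr y) = 0 := by
    rintro ⟨c, s⟩ ⟨t, c'⟩
    simp only [Matrix.mul_apply, Matrix.conjTranspose_apply, Complex.star_def, eveVec,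
      Matrix.of_apply]
    by_cases ht : t = k ∨ t = m
    · simp [ht]
    · simp only [ht, if_false]
      push Not at ht
      have hz : ∀ i j l, i = k ∨ i = m → j = k ∨ j = m → l = k ∨ l = m →
          S (t, i) (j, l) = 0 := by
        intro i j l hi hj hl
        refine h.zero _ _ _ _ ?_
        rintro (⟨h1, -⟩ | ⟨h1, -⟩ | ⟨h1, -⟩)
        · rcases hi with hi | hi <;> simp_all
        · rcases hj with hi | hi <;> simp_all
        · rcases hl with hi | hi <;> simp_all
      have : ∀ e, (starRingEnd ℂ) (1 / (√2 : ℂ) * (Ψ ((k, if c = true then m else k), e)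
            + sgn s * Ψ ((m, if c = true then k else m), e)))
          * Ψ ((t, if c' = true then m else k), e)
          = 1 / (√2 : ℂ) * (Ψ ((t, if c' = true then m else k), e)
              * (starRingEnd ℂ) (Ψ ((k, if c = true then m else k), e)))
            + 1 / (√2 : ℂ) * sgn s * (Ψ ((t, if c' = true then m else k), e)
              * (starRingEnd ℂ) (Ψ ((m, if c = true then k else m), e))) := by
        intro e
        simp only [map_mul, map_add, map_div₀, map_one, Complex.conj_ofReal, conj_sgn]
        ring
      simp_rw [this]
      rw [Finset.sum_add_distrib, ← Finset.mul_sum, ← Finset.mul_sum, hin, hin,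
        hz _ _ _ (by cases c' <;> simp) (by simp) (by cases c <;> simp),
        hz _ _ _ (by cases c' <;> simp) (by simp) (by cases c <;> simp)]
      simp
  ext i j
  rcases i with ⟨c, s⟩ | ⟨t, c⟩ <;> rcases j with ⟨c', s'⟩ | ⟨t', c'⟩
  · have : ((eveVec Ψ k m).conjTranspose * eveVec Ψ k m) (Sum.inl (c, s)) (Sum.inl (c', s'))
        = 1 / 2 * (S (k, if c' then m else k) (k, if c then m else k)
          + sgn s * S (k, if c' then m else k) (m, if c then k else m)
          + sgn s' * S (m, if c' then k else m) (k, if c then m else k)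
          + sgn s * sgn s' * S (m, if c' then k else m) (m, if c then k else m)) := by
      simp only [← hin, Finset.mul_sum, ← Finset.sum_add_distrib, Matrix.mul_apply]
      refine Finset.sum_congr rfl fun e _ => ?_
      simp only [Matrix.conjTranspose_apply, Complex.star_def, eveVec, Matrix.of_apply,
        map_mul, map_add, map_div₀, map_one, Complex.conj_ofReal, conj_sgn]
      rw [mul_mul_mul_comm, inv_sqrt_two_mul_self]
      ring
    rw [this]
    have hp : S (k, m) (k, m) = p := h.diag_m k hne
    have hp' : S (m, k) (m, k) = p := h.diag_k m hne'
    have z := h.zero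
    cases c <;> cases c'
    · simp only [Bool.false_eq_true, if_false, h.kk_kk, h.mm_mm, h.kk_mm, h.mm_kk]
      cases s <;> cases s' <;> simp [sgn, realSgn, eveNorm] <;> ring
    · simp only [Bool.false_eq_true, if_false, if_true,
        z k m k k (by simp [Paired, hne, hne']), z k m m m (by simp [Paired, hne]),
        z m k k k (by simp [Paired, hne']), z m k m m (by simp [Paired, hne, hne'])]
      simp
    · simp only [Bool.false_eq_true, if_false, if_true,
        z k k k m (by simp [Paired, hne]), z k k m k (by simp [Paired, hne, hne']),
        z m m k m (by simp [Paired, hne, hne']), z m m m k (by simp [Paired, hne'])]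
      simp
    · simp only [if_true, hp, hp', h.km_mk, h.mk_km]
      cases s <;> cases s' <;> simp [sgn, realSgn, eveNorm] <;> ring
  · rw [hlr]; simp
  · rw [← hherm.apply, hlr]; simp
  · simp only [Matrix.mul_apply, Matrix.conjTranspose_apply, Complex.star_def, eveVec,
      Matrix.of_apply, Matrix.diagonal_apply, eveNorm, Sum.inr.injEq, Prod.mk.injEq]
    by_cases ht : t = k ∨ t = m
    · simp [ht]
    · by_cases ht' : t' = k ∨ t' = m
      · simp only [ht', if_true, mul_zero, Finset.sum_const_zero]
        rw [if_neg]
        rintro ⟨rfl, -⟩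
        exact ht ht'
      · simp only [ht, ht', if_false]
        have : ∀ e, (starRingEnd ℂ) (Ψ ((t, if c = true then m else k), e)) *
            Ψ ((t', if c' = true then m else k), e) = Ψ ((t', if c' = true then m else k), e) *
            (starRingEnd ℂ) (Ψ ((t, if c = true then m else k), e)) := fun e => mul_comm _ _
        simp_rw [this]
        rw [hin]
        push Not at ht ht'
        by_cases heq : t = t' ∧ c = c'
        · rw [if_pos heq]
          obtain ⟨rfl, rfl⟩ := heq
          cases c
          · simpa using h.diag_k t ht.1
          · simpa using h.diag_m t ht.2
        · rw [if_neg heq]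
          refine h.zero _ _ _ _ ?_
          rintro (⟨h1, -⟩ | ⟨h1, h2⟩ | ⟨-, h1⟩)
          · cases c' <;> simp_all
          · cases c <;> cases c' <;> simp_all
          · cases c' <;> simp_all

/-! ### The weights of one round -/

/-- The weight g^{3/4}/N^{1/4} is chosen so that both Cauchy–Schwarz factors have the same value √N
(√g + √h), N = g + h, as a bound for a sector with squared norms g, h; this is the share of g in the
first factor. -/
theorem div_weight {g N : ℝ} (hg : 0 ≤ g) (hN : g ≤ N) :
    (g / (√√g ^ 3 / √√N)) ^ 2 = √N * √g := by
  have h1 : √√g ^ 4 = g := by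
    rw [show √√g ^ 4 = (√√g ^ 2) ^ 2 by ring, Real.sq_sqrt (Real.sqrt_nonneg _), Real.sq_sqrt hg]
  have h2 : √√N ^ 2 = √N := Real.sq_sqrt (Real.sqrt_nonneg _)
  have h3 : √√g ^ 2 = √g := Real.sq_sqrt (Real.sqrt_nonneg _)
  rcases hg.eq_or_lt with rfl | hg
  · simp
  · have ha : 0 < √√g := Real.sqrt_pos.2 (Real.sqrt_pos.2 hg)
    have : g / (√√g ^ 3 / √√N) = √√N * √√g := by
      conv_lhs => enter [1]; rw [← h1]
      field_simp
    rw [this, mul_pow, h2, h3]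

/-- In fourth roots α, γ of g, h this is (α³ + γ³)² ≤ (α⁴ + γ⁴)(α² + γ²), whose defect is α²γ²(α -
γ)². -/
theorem weight_add_sq_le {g h : ℝ} (hg : 0 ≤ g) (hh : 0 ≤ h) :
    (√√g ^ 3 / √√(g + h) + √√h ^ 3 / √√(g + h)) ^ 2 ≤ √(g + h) * (√g + √h) := by
  have h1 : ∀ x : ℝ, 0 ≤ x → √√x ^ 4 = x := fun x hx => by
    rw [show √√x ^ 4 = (√√x ^ 2) ^ 2 by ring, Real.sq_sqrt (Real.sqrt_nonneg _), Real.sq_sqrt hx]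
  have h2 : ∀ x : ℝ, √√x ^ 2 = √x := fun x => Real.sq_sqrt (Real.sqrt_nonneg _)
  rcases (add_nonneg hg hh).eq_or_lt with h0 | h0
  · rw [← h0]; simp
  · have hn : 0 < √√(g + h) := Real.sqrt_pos.2 (Real.sqrt_pos.2 h0)
    have e := h1 _ h0.le
    have e1 := h1 g hg
    have e2 := h1 h hh
    have f := h2 (g + h)
    have f1 := h2 g
    have f2 := h2 h
    generalize √√(g + h) = ν at *
    generalize √√g = α at *
    generalize √√h = γ at *
    rw [← f, ← f1, ← f2, ← add_div, div_pow, div_le_iff₀ (by positivity)]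
    have : ν ^ 2 * (α ^ 2 + γ ^ 2) * ν ^ 2 = (α ^ 4 + γ ^ 4) * (α ^ 2 + γ ^ 2) := by
      rw [e1, e2, ← e]; ring
    rw [this]
    nlinarith [mul_nonneg (mul_nonneg (sq_nonneg α) (sq_nonneg γ)) (sq_nonneg (α - γ))]

theorem eveWeight_eq_zero {d : ℕ} {D : Label d → ℝ} (hD : ∀ j, 0 ≤ D j) {j : Label d}
    (h : eveWeight D j = 0) : D j = 0 := by
  rcases j with ⟨c, s⟩ | x
  · simp only [eveWeight, div_eq_zero_iff, pow_eq_zero_iff (three_ne_zero)] at h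
    rcases h with h | h
    · rw [Real.sqrt_eq_zero (Real.sqrt_nonneg _), Real.sqrt_eq_zero (hD _)] at h
      exact h
    · have h1 := hD (Sum.inl (false, s))
      have h2 := hD (Sum.inl (true, s))
      rw [Real.sqrt_eq_zero (Real.sqrt_nonneg _), Real.sqrt_eq_zero (by linarith)] at h
      cases c <;> linarith
  · simpa [eveWeight, Real.sqrt_eq_zero (hD _)] using h

/-- Each sector contributes (w₀ + w₁)² for equal bits and (w₀ - w₁)² for opposite bits; hence the
kernel is nonnegative. -/
theorem sum_eveCoeff_mul {d : ℕ} (w : Label d → ℝ) (s s' : Bool) :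
    ∑ i, ∑ j, w i * w j * (eveCoeff d s i j * eveCoeff d s' i j) =
      ((d : ℝ) / 2) ^ 2 * ((∑ t : Bool, (w (Sum.inl (false, t)) ^ 2 + w (Sum.inl (true, t)) ^ 2
        + 2 * (realSgn s * realSgn s') * (w (Sum.inl (false, t)) * w (Sum.inl (true, t)))))
        + ∑ x, w (Sum.inr x) ^ 2) := by
  have hrr : ∀ x : Fin d × Bool, ∑ y : Fin d × Bool, w (Sum.inr x) * w (Sum.inr y) *
      (eveCoeff d s (Sum.inr x) (Sum.inr y) * eveCoeff d s' (Sum.inr x) (Sum.inr y))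
      = ((d : ℝ) / 2) ^ 2 * w (Sum.inr x) ^ 2 := by
    intro x
    rw [Finset.sum_eq_single x]
    · simp [eveCoeff]; ring
    · intro y _ hy; simp [eveCoeff, hy.symm]
    · simp
  simp only [Fintype.sum_sum_type, Finset.sum_add_distrib]
  rw [Finset.sum_congr rfl fun x _ => hrr x, ← Finset.mul_sum]
  have h1 : ∀ (x : Bool × Bool) (y : Fin d × Bool), eveCoeff d s (Sum.inl x) (Sum.inr y) = 0 :=
    fun _ _ => rfl
  have h2 : ∀ (x : Bool × Bool) (y : Fin d × Bool), eveCoeff d s (Sum.inr y) (Sum.inl x) = 0 :=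
    fun _ _ => rfl
  simp only [h1, h2, zero_mul, mul_zero, Finset.sum_const_zero, add_zero, zero_add]
  simp only [Fintype.sum_prod_type, Fintype.sum_bool, eveCoeff]
  generalize w (Sum.inl (false, false)) = w1
  generalize w (Sum.inl (false, true)) = w2
  generalize w (Sum.inl (true, false)) = w3
  generalize w (Sum.inl (true, true)) = w4
  simp only [if_true, if_false, Bool.false_eq_true, reduceCtorEq, realSgn_true,
    realSgn_false]
  ring

theorem sqrt_mul_add_sqrt_mul_le {a b x y : ℝ} (ha : 0 ≤ a) (hb : 0 ≤ b) (hx : 0 ≤ x)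
    (hy : 0 ≤ y) : √a * √x + √b * √y ≤ √(a + b) * √(x + y) := by
  obtain ⟨a, ha', rfl⟩ : ∃ s, 0 ≤ s ∧ a = s ^ 2 := ⟨√a, Real.sqrt_nonneg _, (Real.sq_sqrt ha).symm⟩
  obtain ⟨b, hb', rfl⟩ : ∃ s, 0 ≤ s ∧ b = s ^ 2 := ⟨√b, Real.sqrt_nonneg _, (Real.sq_sqrt hb).symm⟩
  obtain ⟨x, hx', rfl⟩ : ∃ s, 0 ≤ s ∧ x = s ^ 2 := ⟨√x, Real.sqrt_nonneg _, (Real.sq_sqrt hx).symm⟩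
  obtain ⟨y, hy', rfl⟩ : ∃ s, 0 ≤ s ∧ y = s ^ 2 := ⟨√y, Real.sqrt_nonneg _, (Real.sq_sqrt hy).symm⟩
  rw [Real.sqrt_sq ha', Real.sqrt_sq hb', Real.sqrt_sq hx', Real.sqrt_sq hy',
    ← Real.sqrt_mul (by positivity)]
  apply Real.le_sqrt_of_sq_le
  nlinarith [sq_nonneg (a * y - b * x)]

theorem leakBase_half {d : ℕ} (hd : 3 ≤ d) {A p : ℝ}
    (hX : d * (A + (d - 1) * p) = 1) :
    leakBase d (d * (d - 2) * p / 2) =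
      d / 2 * (2 * (d - 2) * p + 2 * (√(A + p) * (√A + √p))) := by
  have hd' : (3 : ℝ) ≤ d := by exact_mod_cast hd
  have hc : 0 < (d : ℝ) - 2 := by linarith
  have hd0 : (0 : ℝ) ≤ d := by linarith
  rw [leakBase, show 2 * (d * (d - 2) * p / 2) = d * (d - 2) * p by ring,
    show 1 - d * (d - 2) * p = d * (A + p) by linear_combination -hX,
    show 1 - d * (d - 2) * p * (((d : ℝ) - 1) / (d - 2)) = d * A by
      field_simp; linear_combination -hX,
    ← Real.sqrt_div' _ hc.le, show d * (d - 2) * p / (d - 2) = d * p by field_simp,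
    Real.sqrt_mul hd0, Real.sqrt_mul hd0, Real.sqrt_mul hd0]
  linear_combination (√(A + p) * (√A + √p)) * Real.mul_self_sqrt hd0

/-- Cauchy–Schwarz between the two sectors: the leakage is largest when they are balanced, that is
for B = q = 0. -/
theorem sum_sqrt_le {A B p q : ℝ} (h1 : 0 ≤ A + B) (h2 : 0 ≤ A - B) (h3 : 0 ≤ p + q)
    (h4 : 0 ≤ p - q) :
    √((A - B) + (p - q)) * (√(A - B) + √(p - q)) + √((A + B) + (p + q)) * (√(A + B) + √(p + q)) ≤
      2 * (√(A + p) * (√A + √p)) := by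
  have e1 := sqrt_mul_add_sqrt_mul_le (add_nonneg h2 h4) (add_nonneg h1 h3) h2 h1
  have e2 := sqrt_mul_add_sqrt_mul_le (add_nonneg h2 h4) (add_nonneg h1 h3) h4 h3
  rw [show A - B + (p - q) + (A + B + (p + q)) = 2 * (A + p) by ring] at e1 e2
  rw [show A - B + (A + B) = 2 * A by ring, Real.sqrt_mul zero_le_two, Real.sqrt_mul zero_le_two]
    at e1
  rw [show p - q + (p + q) = 2 * p by ring, Real.sqrt_mul zero_le_two, Real.sqrt_mul zero_le_two]
    at e2
  have h22 := Real.mul_self_sqrt (zero_le_two (α := ℝ))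
  have e3 : √2 * √(A + p) * (√2 * √A) = 2 * (√(A + p) * √A) := by
    linear_combination (√(A + p) * √A) * h22
  have e4 : √2 * √(A + p) * (√2 * √p) = 2 * (√(A + p) * √p) := by
    linear_combination (√(A + p) * √p) * h22
  rw [mul_add, mul_add, mul_add, mul_add]
  linarith

theorem exists_roundFactor {d : ℕ} (hd : 3 ≤ d) {ε : Type*} [Fintype ε] [DecidableEq ε]
    {ρ : Matrix (Fin d × Fin d) (Fin d × Fin d) ℂ} {b : ℝ}
    (hb : NoiseConstraint (symmetrise ρ) b) {Ψ : (Fin d × Fin d) × ε → ℂ}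
    (hΨ : IsPurification (symmetrise ρ) Ψ) {r k : Fin d} (hr : (r : ℕ) ≠ 0) :
    ∃ P : ℝ, 0 ≤ P ∧ P * (((d : ℝ) - 1) / ((d : ℝ) - 2)) ≤ 1 ∧ P ≤ 2 * b ∧
      Nonempty (RoundFactor (Label d) (eveState Ψ r k) (leakBase d (P / 2))) := by
  have hd' : (3 : ℝ) ≤ d := by exact_mod_cast hd
  have hc : 0 < (d : ℝ) - 2 := by linarith
  have hd0 : 0 < d := by omega
  have : NeZero d := ⟨hd0.ne'⟩
  have hkm : k ≠ k + r := by
    intro h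
    have : r = 0 := left_eq_add.1 h
    exact hr (by rw [this]; rfl)
  obtain ⟨A, B, p, q, hS⟩ := exists_symValues hΨ hkm
  obtain ⟨hX, hY⟩ := hS.of_noise hd0 hr hb
  have hgram := eveVec_gram hΨ hS
  set D := eveNorm k (k + r) A B p q with hD
  have hDnn : ∀ j, 0 ≤ D j := by
    intro j
    have h1 := (Matrix.posSemidef_conjTranspose_mul_self (eveVec Ψ k (k + r))).diag_nonneg (i := j)
    rw [hgram, Matrix.diagonal_apply_eq] at h1
    exact_mod_cast h1
  have h1 : 0 ≤ A + B := by simpa [hD, eveNorm, realSgn] using hDnn (Sum.inl (false, false))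
  have h2 : 0 ≤ A - B := by
    simpa [hD, eveNorm, realSgn, sub_eq_add_neg] using hDnn (Sum.inl (false, true))
  have h3 : 0 ≤ p + q := by simpa [hD, eveNorm, realSgn] using hDnn (Sum.inl (true, false))
  have h4 : 0 ≤ p - q := by
    simpa [hD, eveNorm, realSgn, sub_eq_add_neg] using hDnn (Sum.inl (true, true))
  have hA : 0 ≤ A := by linarith
  have hp : 0 ≤ p := by linarith
  have hwnn : ∀ j, 0 ≤ eveWeight D j := by
    rintro (⟨c, s⟩ | x)
    · exact div_nonneg (pow_nonneg (Real.sqrt_nonneg _) _) (Real.sqrt_nonneg _)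
    · exact Real.sqrt_nonneg _
  set M := √((A - B) + (p - q)) * (√(A - B) + √(p - q))
    + √((A + B) + (p + q)) * (√(A + B) + √(p + q)) + 2 * (d - 2) * p with hM
  have hM0 : 0 ≤ M := by positivity
  have hrest : ∑ x : Fin d × Bool, D (Sum.inr x) = 2 * (d - 2) * p := by
    have h5 := sum_eq_add_add_sum_ite hkm fun _ : Fin d => p
    simp only [Finset.sum_const, Finset.card_univ, Fintype.card_fin, nsmul_eq_mul] at h5
    simp only [Fintype.sum_prod_type, Fintype.sum_bool, hD, eveNorm, Finset.sum_add_distrib]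
    linarith
  have hfst : ∑ j, (D j / eveWeight D j) ^ 2 = M := by
    have h5 : ∀ x : Fin d × Bool, (D (Sum.inr x) / eveWeight D (Sum.inr x)) ^ 2 = D (Sum.inr x) := by
      intro x
      rw [eveWeight, Real.div_sqrt, Real.sq_sqrt (hDnn _)]
    have h6 : ∀ c s, (D (Sum.inl (c, s)) / eveWeight D (Sum.inl (c, s))) ^ 2 =
        √(D (Sum.inl (false, s)) + D (Sum.inl (true, s))) * √(D (Sum.inl (c, s))) := by
      intro c s
      refine div_weight (hDnn _) ?_
      have := hDnn (Sum.inl (false, s))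
      have := hDnn (Sum.inl (true, s))
      cases c <;> linarith
    rw [Fintype.sum_sum_type, Finset.sum_congr rfl fun x _ => h5 x, hrest, hM,
      Fintype.sum_prod_type]
    simp only [h6, Fintype.sum_bool]
    simp only [hD, eveNorm, realSgn]
    simp only [Bool.false_eq_true, if_true, if_false, one_mul, neg_mul, ← sub_eq_add_neg]
    ring
  have hsnd : ∀ s, ∑ i, ∑ j, eveWeight D i * eveWeight D j *
      (eveCoeff d s i j * eveCoeff d s i j) ≤ ((d : ℝ) / 2) ^ 2 * M := by
    intro s
    rw [sum_eveCoeff_mul, realSgn_mul_self]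
    refine mul_le_mul_of_nonneg_left ?_ (sq_nonneg _)
    have h5 : ∀ x : Fin d × Bool, eveWeight D (Sum.inr x) ^ 2 = D (Sum.inr x) := fun x =>
      Real.sq_sqrt (hDnn _)
    have h6 : ∀ t, eveWeight D (Sum.inl (false, t)) ^ 2 + eveWeight D (Sum.inl (true, t)) ^ 2
        + 2 * 1 * (eveWeight D (Sum.inl (false, t)) * eveWeight D (Sum.inl (true, t)))
        ≤ √(D (Sum.inl (false, t)) + D (Sum.inl (true, t))) *
          (√(D (Sum.inl (false, t))) + √(D (Sum.inl (true, t)))) := by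
      intro t
      refine le_trans (le_of_eq ?_) (weight_add_sq_le (hDnn _) (hDnn _))
      simp only [eveWeight]
      ring
    rw [Finset.sum_congr rfl fun x _ => h5 x, hrest, hM]
    refine add_le_add_left ((Finset.sum_le_sum fun t _ => h6 t).trans (le_of_eq ?_)) _
    simp only [Fintype.sum_bool, hD, eveNorm, realSgn]
    simp only [Bool.false_eq_true, if_true, if_false, one_mul, neg_mul, ← sub_eq_add_neg]
  have hMT : (d : ℝ) / 2 * M ≤ leakBase d (d * (d - 2) * p / 2) := by
    rw [leakBase_half hd hX]
    have := sum_sqrt_le h1 h2 h3 h4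
    gcongr
    linarith
  -- The weight of Eve's state on the vectors with t ∉ {k, m}. The two bounds on it come from A ≥ 0
  -- and from B + q ≤ A + p.
  refine ⟨d * (d - 2) * p, by positivity, ?_, ?_, ⟨?_⟩⟩
  · have h5 : 1 - d * (d - 2) * p * (((d : ℝ) - 1) / (d - 2)) = d * A := by
      field_simp; linear_combination -hX
    have : 0 ≤ (d : ℝ) * A := by positivity
    linarith
  · have h5 : d * (d - 2) * p + d * (A + p) = 1 := by linear_combination hX
    have : (d : ℝ) * (B + q) ≤ d * (A + p) := by gcongr <;> linarith
    linarith
  exact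
  { V := eveVec Ψ k (k + r)
    D := D
    w := eveWeight D
    o := eveCoeff d
    gram := hgram
    o_symm := eveCoeff_symm
    w_nonneg := hwnn
    D_eq_zero := fun j => eveWeight_eq_zero hDnn
    eq_factor := eveState_factor hd0 hΨ rfl hS hX
    cross_nonneg := by
      intro s s'
      rw [sum_eveCoeff_mul]
      refine mul_nonneg (sq_nonneg _) (add_nonneg (Finset.sum_nonneg fun t _ => ?_)
        (Finset.sum_nonneg fun x _ => sq_nonneg _))
      cases s <;> cases s' <;> simp only [realSgn, if_true, if_false, Bool.false_eq_true] <;>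
        nlinarith [sq_nonneg (eveWeight D (Sum.inl (false, t)) + eveWeight D (Sum.inl (true, t))),
          sq_nonneg (eveWeight D (Sum.inl (false, t)) - eveWeight D (Sum.inl (true, t)))]
    bound := by
      intro s
      rw [hfst]
      calc _ ≤ M * (((d : ℝ) / 2) ^ 2 * M) := mul_le_mul_of_nonneg_left (hsnd s) hM0
        _ = (d / 2 * M) ^ 2 := by ring
        _ ≤ _ := pow_le_pow_left₀ (by positivity) hMT 2 }

end

end RRDPS

/-! ### Assembly of the security bound -/

theorem RRDPS.two_rpow_sub_mul {T : ℝ} (hT : 0 < T) (n ℓ : ℕ) :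
    (2 : ℝ) ^ ((ℓ : ℝ) - n * (1 - 2 * Real.logb 2 T)) = 2 ^ ℓ / 2 ^ n * (T ^ n) ^ 2 := by
  rw [show (ℓ : ℝ) - n * (1 - 2 * Real.logb 2 T) = ℓ - n + Real.logb 2 T * ((n * 2 : ℕ) : ℝ) by
    push_cast; ring, Real.rpow_add two_pos, Real.rpow_sub two_pos, Real.rpow_natCast,
    Real.rpow_natCast, Real.rpow_mul zero_le_two, Real.rpow_logb two_pos (by norm_num) hT,
    Real.rpow_natCast, pow_mul]

theorem theorem1 (d : ℕ) (hd : 3 ≤ d) :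
    ∃ x ∈ Set.Ioo (0 : ℝ) 1, RRDPS.satFun d x = 0 ∧
      (∀ y ∈ Set.Ioo (0 : ℝ) 1, RRDPS.satFun d y = 0 → y = x) ∧
      ∀ (n ℓ : ℕ) (β : ℝ), 0 ≤ β →
      ∀ (υ : Type*) [Fintype υ] [DecidableEq υ] [Nonempty υ]
        (Ext : (Fin n → Bool) → υ → (Fin ℓ → Bool)), RRDPS.IsUniversalHash Ext →
      ∀ (ρ : Fin n → Matrix (Fin d × Fin d) (Fin d × Fin d) ℂ) (b : Fin n → ℝ),
        (∀ i, RRDPS.IsDensity (ρ i)) →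
        (∀ i, RRDPS.NoiseConstraint (RRDPS.symmetrise (ρ i)) (b i)) →
        ∑ i, b i ≤ n * β →
      ∀ (ε : Fin n → Type*) [∀ i, Fintype (ε i)] [∀ i, DecidableEq (ε i)]
        (Ψ : ∀ i, (Fin d × Fin d) × ε i → ℂ),
        (∀ i, RRDPS.IsPurification (RRDPS.symmetrise (ρ i)) (Ψ i)) →
      ∀ (r k : Fin n → Fin d), (∀ i, (r i : ℕ) ≠ 0) →
        RRDPS.distFromUniform (RRDPS.eveJointState Ext Ψ r k) <
          1 / 2 * Real.sqrt
            ((2 : ℝ) ^ ((ℓ : ℝ) -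
              n * (1 - 2 * Real.logb 2 (RRDPS.leakT d (RRDPS.betaStar x) β)))) := by
  obtain ⟨x, hx, hsat⟩ := RRDPS.exists_satFun_eq_zero hd
  refine ⟨x, hx, hsat, fun y hy hsy =>
    (RRDPS.satFun_strictMonoOn hd).injOn hy hx (hsy.trans hsat.symm), ?_⟩
  intro n ℓ β hβ υ _ _ _ Ext hExt ρ b _ hnoise hsum ε _ _ Ψ hΨ r k hr
  choose P hP0 hP1 hPb hR using fun i =>
    RRDPS.exists_roundFactor hd (hnoise i) (hΨ i) (k := k i) (hr i)
  have hT := RRDPS.leakT_pos (d := d) hx.1 hβ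
  have hprod := RRDPS.prod_leakBase_le hd hx hsat hβ hP0 hP1 (by
    calc ∑ i, P i ≤ ∑ i, 2 * b i := Finset.sum_le_sum fun i _ => hPb i
      _ = 2 * ∑ i, b i := (Finset.mul_sum _ _ _).symm
      _ ≤ 2 * (n * β) := by gcongr
      _ = n * (2 * β) := by ring)
  have hnn : 0 ≤ ∏ i, RRDPS.leakBase d (P i / 2) :=
    Finset.prod_nonneg fun i _ => RRDPS.leakBase_nonneg (by linarith [hP0 i])
  refine (RRDPS.distFromUniform_le hExt fun i => (hR i).some).trans_lt ?_
  rw [RRDPS.two_rpow_sub_mul hT]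
  have h2 : (1 : ℝ) ≤ 2 ^ ℓ := one_le_pow₀ one_le_two
  refine mul_lt_mul_of_pos_left (Real.sqrt_lt_sqrt
    (mul_nonneg (div_nonneg (sub_nonneg.2 h2) (by positivity)) (sq_nonneg _)) ?_) (by norm_num)
  calc _ ≤ ((2 : ℝ) ^ ℓ - 1) / 2 ^ n * (RRDPS.leakT d (RRDPS.betaStar x) β ^ n) ^ 2 := by
        have : 0 ≤ ((2 : ℝ) ^ ℓ - 1) / 2 ^ n := div_nonneg (sub_nonneg.2 h2) (by positivity)
        gcongr
    -- Strictness comes from 2^ℓ - 1 < 2^ℓ, as T is positive.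
    _ < _ := by
        gcongr
        linarith
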